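/- **Definitions.** For positive integers $a_1,\dots,a_k$, the *$k$-chain* $C_{a_1,\dots,a_k}$ is the graph whose vertex set is the disjoint union of sets $A_1,\dots,A_k$ with $|A_i|=a_i$, in which, for $1\le i\le k-1$, every vertex of $A_i$ is joined to every vertex of $A_{i+1}$, and which has no other edges. A finite graph is *$n$-connected* if it has more than $n$ vertices and remains connected after the removal of any fewer than $n$ vertices. A *realization* of a graph $G=(V,E)$ in $\mathbb R^d$ is a map $p:V\to\mathbb R^d$; it is *generic* if its $d|V|$ coordinates are algebraically independent over $\mathbb Q$. The framework $G(p)$ is *globally rigid* if every realization $q$ of $G$ in $\mathbb R^d$ with $|q_i-q_j|=|p_i-p_j|$ for all edges $\{i,j\}\in E$ satisfies $|q_i-q_j|=|p_i-p_j|$ for all $i,j\in V$. The graph $G$ is *generically globally rigid* in $\mathbb R^d$ if $G(p)$ is globally rigid for some generic realization $p$ in $\mathbb R^d$. **Proposition.** Let $k\ge 4$ and $d\ge 0$ be integers, and let $C_{a_1,\dots,a_k}$ be a $(d+1)$-connected $k$-chain with exactly $\binom{d+2}{2}$ vertices. Then $C_{a_1,\dots,a_k}$ is not generically globally rigid in $\mathbb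 R^d$; that is, for no generic realization $p$ in $\mathbb R^d$ is the framework $C_{a_1,\dots,a_k}(p)$ globally rigid. Moreover, $C_{a_1,\dots,a_k}$ is isomorphic to a subgraph of a complete bipartite graph $K_{m,n}$ with $m,n\ge d+2$ and $m+n=\binom{d+2}{2}$. -/

import Mathlib

open scoped Finset

namespace Rigidity

/-- The `k`-chain `C_{a₁, …, a_k}`: its vertex set is the disjoint union of independent sets
`A₁, …, A_k` with `|A_i| = a_i`; every vertex of `A_i` is joined to every vertex of `A_{i+1}`, and
there are no other edges. (The index set `{1, …, k}` is `Fin k`, that is `{0, …, k - 1}`.) -/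
def chain {k : ℕ} (a : Fin k → ℕ) : SimpleGraph (Σ i : Fin k, Fin (a i)) where
  Adj u v := (u.1 : ℕ) + 1 = (v.1 : ℕ) ∨ (v.1 : ℕ) + 1 = (u.1 : ℕ)
  symm := ⟨fun _ _ h => h.symm⟩
  loopless := ⟨fun u h => by rcases h with h | h <;> omega⟩

/-- Vertex `n`-connectedness of a finite graph: it has more than `n` vertices, and it stays
connected when any fewer than `n` vertices are removed. -/
def VertexConnected {V : Type*} [Fintype V] (G : SimpleGraph V) (n : ℕ) : Prop :=
  n < Fintype.card V ∧ ∀ S : Finset V, #S < n → (G.induce ((S : Set V)ᶜ)).Connected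

/-- The function sending a realization `p` of the vertices of `G` in `ℝ^d` to the tuple, indexed
by the edges `{i, j}` of `G`, of the numbers `|p_i - p_j|² / 2`. -/
noncomputable def halfSqLength {V : Type*} {d : ℕ} (G : SimpleGraph V)
    (p : V → EuclideanSpace ℝ (Fin d)) : G.edgeSet → ℝ :=
  fun e => Sym2.lift ⟨fun i j => ‖p i - p j‖ ^ 2 / 2, fun i j => congrArg (fun t : ℝ => t ^ 2 / 2) (norm_sub_rev (p i) (p j))⟩ e.1

/-- The framework `G(p)` is globally rigid: every realization `q` with the same edge lengths as `p`
has the same pairwise distances as `p` (the edge lengths of the complete graph `⊤`). -/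
def IsGloballyRigid {V : Type*} {d : ℕ} (G : SimpleGraph V)
    (p : V → EuclideanSpace ℝ (Fin d)) : Prop :=
  ∀ q : V → EuclideanSpace ℝ (Fin d),
    halfSqLength G p = halfSqLength G q →
      halfSqLength (⊤ : SimpleGraph V) p = halfSqLength (⊤ : SimpleGraph V) q

/-- A realization is generic if its coordinates are algebraically independent over `ℚ`. -/
def IsGeneric {V : Type*} {d : ℕ} (p : V → EuclideanSpace ℝ (Fin d)) : Prop :=
  AlgebraicIndependent ℚ (fun x : V × Fin d => p x.1 x.2)

/-- `G` is generically globally rigid in `ℝ^d`: some generic framework of `G` in `ℝ^d` is globally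
rigid. Its negation says that *no* generic framework of `G` in `ℝ^d` is globally rigid. -/
def GenericallyGloballyRigid {V : Type*} (d : ℕ) (G : SimpleGraph V) : Prop :=
  ∃ p : V → EuclideanSpace ℝ (Fin d), IsGeneric p ∧ IsGloballyRigid G p

end Rigidity

/-!
The idea is to exhibit a second realization explicitly, by a form of Ivory's theorem on confocal
quadrics. Splitting the classes of the chain by parity makes it a subgraph of a complete bipartite
graph with classes `P` and `Q`; each class contains an interior part of the chain, of size at
least `d + 1` by connectivity, and another part, so it has at least `d + 2` vertices.

Let `f` be a quadratic function on `ℝ^d` that vanishes at all the points `p i` of `P` and for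
which, for every point `q j` of `Q`, the function `y ↦ |y - q j|² + f y` (`QuadFamily.gap`) has
minimum `0`, attained at `y j`. All these functions have the same quadratic part, a nonnegative
form `|T z|²`, so they are `|T (y - y j)|²`; evaluating at `p i` gives
`|p i - q j| = |T p i - T (y j)|`. Hence the points `T p i`, `T (y j)` realize the bipartite graph
with the same edge lengths. If all distances were preserved, the quadratic part of `f` would vanish
on the differences of the spanning points `p i`, so `f` would be affine and thus zero
(`IsGeneric.not_isGloballyRigid`).

What remains is to find such an `f ≠ 0`. Since `P` and `Q` have together as many points as the
dimension of the space of quadratic functions, for generic points the functions vanishing on `P` are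
parametrized by their values `x j` at the points `q j` (`IsGeneric.exists_interpolates`). The
parameters for which all the minima are at least `-δ` form a convex set
(`QuadFamily.slab`), which is compact because `P` spans `ℝ^d`, and on which all the minima are
attained because `Q` spans `ℝ^d`. Project the standard simplex radially to its boundary: at every
boundary point some minimum is nonpositive, and on the facet `x j = 0` the `j`-th one is. So the
KKM theorem gives a point `x ≥ 0` at which all the minima lie in `[-δ, 0]`
(`QuadFamily.Interpolates.exists_mem_slab`). Near `0` the `j`-th minimum is `x j` up to second
order, so these points stay away from `0`, and they accumulate at a nonzero solution as `δ → 0`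
(`QuadFamily.Interpolates.exists_tight`). The KKM theorem itself is deduced from Scarf's
combinatorial lemma (`exists_isDominant_image_eq_univ`), which is a parity argument.
-/

namespace Rigidity

/-! ### Scarf's pivoting lemma -/

section Scarf

variable {I X β : Type*} [LinearOrder β]

/-- A finite set `W` is *dominant* for a family `r i` of rankings of `X` if no point of `X` lies
strictly above some element of `W` in every one of the rankings. -/
def IsDominant (r : I → X → β) (W : Finset X) : Prop :=
  ∀ y, ∃ i, ∀ w ∈ W, r i y ≤ r i w

lemma IsDominant.mono {r : I → X → β} {W W' : Finset X} (h : IsDominant r W) (hW : W' ⊆ W) :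
    IsDominant r W' := fun y => (h y).imp fun _ hi w hw => hi w (hW hw)

/-- A choice of lowest elements of `W`, one for each ranking. -/
def IsArgmin (r : I → X → β) (W : Finset X) (m : I → X) : Prop :=
  ∀ i, m i ∈ W ∧ ∀ w ∈ W, r i (m i) ≤ r i w

lemma exists_isArgmin (r : I → X → β) {W : Finset X} (hW : W.Nonempty) :
    ∃ m, IsArgmin r W m := by
  choose m hm using fun i => W.exists_min_image (r i) hW
  exact ⟨m, hm⟩

variable {r : I → X → β} {W : Finset X} {m : I → X}

lemma IsArgmin.eq_of_le (hr : ∀ i, Function.Injective (r i))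
    (hm : IsArgmin r W m) {i : I} {x : X} (hx : x ∈ W)
    (h : ∀ w ∈ W, r i x ≤ r i w) : x = m i :=
  hr i (le_antisymm (h _ (hm i).1) ((hm i).2 _ hx))

/-- Every element of a dominant set is the lowest one in some ranking. -/
lemma IsArgmin.image_eq [Fintype I] [DecidableEq X] (hr : ∀ i, Function.Injective (r i))
    (hm : IsArgmin r W m) (hW : IsDominant r W) :
    Finset.univ.image m = W := by
  ext x
  constructor
  · intro hx
    obtain ⟨i, -, rfl⟩ := Finset.mem_image.1 hx
    exact (hm i).1
  · intro hx
    obtain ⟨i, hi⟩ := hW x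
    exact Finset.mem_image.2 ⟨i, Finset.mem_univ _, (hm.eq_of_le hr hx hi).symm⟩

/-- The points lying above all of `W` in every ranking but the `k`-th one, where `m` selects the
lowest elements of `W`. -/
def upperRegion (r : I → X → β) (m : I → X) (k : I) : Set X :=
  {y | ∀ i, i ≠ k → r i (m i) < r i y}

/-- The highest points, in the `k`-th ranking, of `upperRegion r m k`. -/
def IsPivot (r : I → X → β) (m : I → X) (k : I) (x : X) : Prop :=
  x ∈ upperRegion r m k ∧ ∀ y ∈ upperRegion r m k, r k y ≤ r k x

lemma exists_isPivot [Finite X] {k : I} (h : (upperRegion r m k).Nonempty) :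
    ∃ x, IsPivot r m k x :=
  Set.exists_max_image _ (r k) (Set.toFinite _) h

lemma IsPivot.unique {k : I} {x y : X} (hr : ∀ i, Function.Injective (r i))
    (hx : IsPivot r m k x) (hy : IsPivot r m k y) : x = y :=
  hr k (le_antisymm (hy.2 _ hx.1) (hx.2 _ hy.1))

lemma IsPivot.isDominant_insert [DecidableEq X] (hm : IsArgmin r W m) (hW : IsDominant r W)
    {k : I} {x : X} (hx : IsPivot r m k x) : IsDominant r (insert x W) := by
  have hkx : ∀ w ∈ W, r k x ≤ r k w := by
    obtain ⟨i, hi⟩ := hW x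
    by_cases h : i = k
    · exact h ▸ hi
    · exact absurd (hx.1 i h) (hi _ (hm i).1).not_gt
  intro y
  by_cases hy : y ∈ upperRegion r m k
  · refine ⟨k, fun w hw => ?_⟩
    rcases Finset.mem_insert.1 hw with rfl | hw
    · exact hx.2 _ hy
    · exact (hx.2 _ hy).trans (hkx w hw)
  · simp only [upperRegion, Set.mem_ofPred_eq, not_forall, not_lt] at hy
    obtain ⟨i, hik, hi⟩ := hy
    refine ⟨i, fun w hw => hi.trans ?_⟩
    rcases Finset.mem_insert.1 hw with rfl | hw
    · exact (hx.1 i hik).le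
    · exact (hm i).2 w hw

/-- If a dominant set with one element fewer than there are rankings has the same lowest element
in the rankings `i₁` and `i₂`, then the points that can be added to it are precisely the pivots
for `i₁` and for `i₂`. -/
lemma isDominant_insert_iff [Fintype I] [DecidableEq X]
    (hr : ∀ i, Function.Injective (r i)) (hm : IsArgmin r W m)
    (hW : IsDominant r W) (hcard : #W + 1 = Fintype.card I) {i₁ i₂ : I} (hne : i₁ ≠ i₂)
    (heq : m i₁ = m i₂) (x : X) :
    (x ∉ W ∧ IsDominant r (insert x W)) ↔ IsPivot r m i₁ x ∨ IsPivot r m i₂ x := by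
  constructor
  · rintro ⟨hxW, hdom⟩
    obtain ⟨m', hm'⟩ := exists_isArgmin r (Finset.insert_nonempty x W)
    have himg := hm'.image_eq hr hdom
    have hinj : Function.Injective m' := by
      rw [← Set.injOn_univ, ← Finset.coe_univ, ← Finset.card_image_iff, himg,
        Finset.card_insert_of_notMem hxW, hcard, Finset.card_univ]
    obtain ⟨k, hk⟩ := hdom x
    have hxk : x = m' k := hm'.eq_of_le hr (Finset.mem_insert_self _ _) hk
    have hm_eq : ∀ i, i ≠ k → m' i = m i := fun i hik => by
      refine hm.eq_of_le hr ?_ fun w hw => (hm' i).2 w (Finset.mem_insert_of_mem hw)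
      refine Finset.mem_of_mem_insert_of_ne (hm' i).1 fun h => hik (hinj ?_)
      rw [h, hxk]
    have hpivot : IsPivot r m k x := by
      refine ⟨fun i hik => lt_of_le_of_ne ?_ fun h => hxW ?_, fun y hy => ?_⟩
      · rw [← hm_eq i hik]
        exact (hm' i).2 x (Finset.mem_insert_self _ _)
      · rw [← hr i h]
        exact (hm i).1
      · obtain ⟨i, hi⟩ := hdom y
        by_cases hik : i = k
        · exact hik ▸ hi x (Finset.mem_insert_self _ _)
        · exact absurd (hy i hik) (hi _ (Finset.mem_insert_of_mem (hm i).1)).not_gt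
    by_cases h1 : k = i₁
    · exact Or.inl (h1 ▸ hpivot)
    by_cases h2 : k = i₂
    · exact Or.inr (h2 ▸ hpivot)
    refine absurd (hinj ?_) hne
    rw [hm_eq _ (Ne.symm h1), hm_eq _ (Ne.symm h2), heq]
  · have key : ∀ k, (∀ w ∈ W, ∃ i, i ≠ k ∧ m i = w) → IsPivot r m k x →
        x ∉ W ∧ IsDominant r (insert x W) := by
      intro k hk hx
      refine ⟨fun hxW => ?_, hx.isDominant_insert hm hW⟩
      obtain ⟨i, hik, rfl⟩ := hk x hxW
      exact lt_irrefl _ (hx.1 i hik)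
    have hsurj : ∀ w ∈ W, ∃ i, m i = w := fun w hw => by
      rw [← hm.image_eq hr hW] at hw
      simpa using hw
    rintro (h | h)
    · refine key i₁ (fun w hw => ?_) h
      obtain ⟨i, rfl⟩ := hsurj w hw
      by_cases hi : i = i₁
      · exact ⟨i₂, hne.symm, by rw [hi, heq]⟩
      · exact ⟨i, hi, rfl⟩
    · refine key i₂ (fun w hw => ?_) h
      obtain ⟨i, rfl⟩ := hsurj w hw
      by_cases hi : i = i₂
      · exact ⟨i₁, hne, by rw [hi, heq]⟩
      · exact ⟨i, hi, rfl⟩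

lemma not_isPivot_and (hm : IsArgmin r W m) (hW : IsDominant r W) {i₁ i₂ : I} (hne : i₁ ≠ i₂)
    {x : X} (h₁ : IsPivot r m i₁ x) (h₂ : IsPivot r m i₂ x) : False := by
  obtain ⟨i, hi⟩ := hW x
  by_cases h : i = i₁
  · exact absurd (h₂.1 i (h ▸ hne)) (hi _ (hm i).1).not_gt
  · exact absurd (h₁.1 i h) (hi _ (hm i).1).not_gt

lemma card_completions_eq_one [Fintype I] [Fintype X] [DecidableEq X]
    (hr : ∀ i, Function.Injective (r i)) (hm : IsArgmin r W m)
    (hW : IsDominant r W) (hcard : #W + 1 = Fintype.card I) {i₁ i₂ : I} (hne : i₁ ≠ i₂)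
    (heq : m i₁ = m i₂) (h₁ : (upperRegion r m i₁).Nonempty) (h₂ : upperRegion r m i₂ = ∅)
    [DecidablePred fun x => x ∉ W ∧ IsDominant r (insert x W)] :
    #{x | x ∉ W ∧ IsDominant r (insert x W)} = 1 := by
  obtain ⟨x, hx⟩ := exists_isPivot h₁
  rw [Finset.card_eq_one]
  refine ⟨x, Finset.ext fun y => ?_⟩
  rw [Finset.mem_filter_univ, isDominant_insert_iff hr hm hW hcard hne heq, Finset.mem_singleton]
  constructor
  · rintro (h | h)
    · exact h.unique hr hx
    · exact absurd h.1 (h₂ ▸ Set.notMem_empty y)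
  · rintro rfl
    exact Or.inl hx

lemma card_completions_eq_two [Fintype I] [Fintype X] [DecidableEq X]
    (hr : ∀ i, Function.Injective (r i)) (hm : IsArgmin r W m)
    (hW : IsDominant r W) (hcard : #W + 1 = Fintype.card I) {i₁ i₂ : I} (hne : i₁ ≠ i₂)
    (heq : m i₁ = m i₂) (h₁ : (upperRegion r m i₁).Nonempty)
    (h₂ : (upperRegion r m i₂).Nonempty)
    [DecidablePred fun x => x ∉ W ∧ IsDominant r (insert x W)] :
    #{x | x ∉ W ∧ IsDominant r (insert x W)} = 2 := by
  obtain ⟨x₁, hx₁⟩ := exists_isPivot h₁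
  obtain ⟨x₂, hx₂⟩ := exists_isPivot h₂
  rw [Finset.card_eq_two]
  refine ⟨x₁, x₂, fun h => not_isPivot_and hm hW hne hx₁ (h ▸ hx₂), Finset.ext fun y => ?_⟩
  rw [Finset.mem_filter_univ, isDominant_insert_iff hr hm hW hcard hne heq, Finset.mem_insert,
    Finset.mem_singleton]
  constructor
  · rintro (h | h)
    · exact Or.inl (h.unique hr hx₁)
    · exact Or.inr (h.unique hr hx₂)
  · rintro (rfl | rfl)
    · exact Or.inl hx₁
    · exact Or.inr hx₂

/-- A set with as many elements as there are colours that misses a colour has an even number of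
elements whose removal leaves all the colours except `i₀`. -/
lemma even_card_removals [Fintype I] [DecidableEq I] [DecidableEq X] (c : X → I) (i₀ : I)
    (hcard : #W = Fintype.card I) (hc : W.image c ≠ Finset.univ) :
    Even #{x ∈ W | (W.erase x).image c = Finset.univ.erase i₀} := by
  by_cases hex : ∃ x ∈ W, (W.erase x).image c = Finset.univ.erase i₀
  · obtain ⟨x, hx, hxc⟩ := hex
    have hsub : Finset.univ.erase i₀ ⊆ W.image c := by
      rw [← hxc]; exact Finset.image_subset_image (Finset.erase_subset _ _)
    have himg : W.image c = Finset.univ.erase i₀ := by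
      refine (Finset.Subset.antisymm hsub fun i hi => ?_).symm
      rw [Finset.mem_erase]
      refine ⟨?_, Finset.mem_univ _⟩
      rintro rfl
      refine hc (Finset.eq_univ_iff_forall.2 fun j => ?_)
      by_cases hj : j = i
      · exact hj ▸ hi
      · exact hsub (Finset.mem_erase.2 ⟨hj, Finset.mem_univ _⟩)
    have hcx : c x ∈ (W.erase x).image c := by
      rw [hxc, ← himg]; exact Finset.mem_image_of_mem _ hx
    obtain ⟨y, hy, hyx⟩ := Finset.mem_image.1 hcx
    obtain ⟨hne, hyW⟩ := Finset.mem_erase.1 hy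
    have hinj : Set.InjOn c (W.erase x : Finset X) := by
      rw [← Finset.card_image_iff, hxc, Finset.card_erase_of_mem (Finset.mem_univ _),
        Finset.card_erase_of_mem hx, hcard, Finset.card_univ]
    have htwo : {z ∈ W | (W.erase z).image c = Finset.univ.erase i₀} = {x, y} := by
      ext z
      simp only [Finset.mem_filter, Finset.mem_insert, Finset.mem_singleton]
      constructor
      · rintro ⟨hz, hzc⟩
        by_contra! hcon
        -- `x` and `y` have the same colour, and removing `z` leaves both of them.
        have hinj' : Set.InjOn c (W.erase z : Finset X) := by
          rw [← Finset.card_image_iff, hzc, Finset.card_erase_of_mem (Finset.mem_univ _),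
            Finset.card_erase_of_mem hz, hcard, Finset.card_univ]
        exact hne (hinj' (Finset.mem_coe.2 (Finset.mem_erase.2 ⟨hcon.2.symm, hyW⟩))
          (Finset.mem_coe.2 (Finset.mem_erase.2 ⟨hcon.1.symm, hx⟩)) hyx)
      · rintro (rfl | rfl)
        · exact ⟨hx, hxc⟩
        · refine ⟨hyW, ?_⟩
          rw [← himg]
          refine Finset.Subset.antisymm (Finset.image_subset_image (Finset.erase_subset _ _)) ?_
          intro i hi
          obtain ⟨w, hw, rfl⟩ := Finset.mem_image.1 hi
          by_cases hwz : w = z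
          · rw [hwz, hyx]
            exact Finset.mem_image_of_mem _ (Finset.mem_erase.2 ⟨hne.symm, hx⟩)
          · exact Finset.mem_image_of_mem _ (Finset.mem_erase.2 ⟨hwz, hw⟩)
    rw [htwo, Finset.card_pair hne.symm]
    exact even_two
  · push Not at hex
    rw [Finset.filter_false_of_mem hex]
    exact ⟨0, rfl⟩

/-- **Scarf's lemma**, in the form of Sperner's lemma: if `X` contains slack points `s i`, where
`s i` is lowest in the ranking `i` and is above all non-slack points in the other rankings, then
every colouring that gives `s i` the colour `i` has a dominant set on which all colours occur
exactly once. -/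
theorem exists_isDominant_image_eq_univ [Fintype I] [Nontrivial I] [DecidableEq I] [Fintype X]
    [DecidableEq X] (hr : ∀ i, Function.Injective (r i)) (s : I → X)
    (hs : ∀ i y, r i (s i) ≤ r i y)
    (hs' : ∀ i j, i ≠ j → ∀ t, (∀ k, t ≠ s k) → r i t < r i (s j))
    (t₀ : X) (ht₀ : ∀ k, t₀ ≠ s k) (c : X → I) (hc : ∀ i, c (s i) = i) :
    ∃ W : Finset X, #W = Fintype.card I ∧ IsDominant r W ∧ W.image c = Finset.univ := by
  classical
  by_contra! hcon
  obtain ⟨i₀⟩ := (inferInstance : Nonempty I)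
  have hsinj : Function.Injective s := fun i j h => by rw [← hc i, h, hc j]
  have hpos : 1 < Fintype.card I := Fintype.one_lt_card
  have hcardErase : #(Finset.univ.erase i₀) + 1 = Fintype.card I :=
    Finset.card_erase_add_one (Finset.mem_univ _)
  -- Rooms are the dominant sets with as many elements as there are colours; doors have one element
  -- fewer and carry all the colours except `i₀`.
  let doors : Finset (Finset X) := {W | #W + 1 = Fintype.card I ∧ IsDominant r W ∧
    W.image c = Finset.univ.erase i₀}
  let rooms : Finset (Finset X) := {W | #W = Fintype.card I ∧ IsDominant r W}
  -- Each pair of a room and a door in it, which differ by one point, is counted in two ways.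
  have hcount : ∑ W ∈ doors, #{x | x ∉ W ∧ IsDominant r (insert x W)} =
      ∑ W ∈ rooms, #{x ∈ W | (W.erase x).image c = Finset.univ.erase i₀} := by
    rw [← Finset.card_sigma, ← Finset.card_sigma]
    refine Finset.card_nbij' (fun p => ⟨insert p.2 p.1, p.2⟩) (fun p => ⟨p.1.erase p.2, p.2⟩)
      ?_ ?_ ?_ ?_
    · rintro ⟨W, x⟩ h
      simp only [doors, rooms, Finset.coe_sigma, Set.mem_sigma_iff, Finset.mem_coe,
        Finset.mem_filter, Finset.mem_univ, true_and] at h ⊢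
      obtain ⟨⟨h1, h2, h3⟩, h4, h5⟩ := h
      refine ⟨⟨by rw [Finset.card_insert_of_notMem h4, h1], h5⟩, Finset.mem_insert_self _ _, ?_⟩
      rw [Finset.erase_insert h4, h3]
    · rintro ⟨W, x⟩ h
      simp only [doors, rooms, Finset.coe_sigma, Set.mem_sigma_iff, Finset.mem_coe,
        Finset.mem_filter, Finset.mem_univ, true_and] at h ⊢
      obtain ⟨⟨h1, h2⟩, h4, h5⟩ := h
      refine ⟨⟨by rw [Finset.card_erase_add_one h4, h1], h2.mono (Finset.erase_subset _ _), h5⟩,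
        Finset.notMem_erase _ _, ?_⟩
      rwa [Finset.insert_erase h4]
    · rintro ⟨W, x⟩ h
      simp only [Finset.coe_sigma, Set.mem_sigma_iff, Finset.mem_coe,
        Finset.mem_filter_univ] at h
      simp [Finset.erase_insert h.2.1]
    · rintro ⟨W, x⟩ h
      simp only [Finset.coe_sigma, Set.mem_sigma_iff, Finset.mem_coe,
        Finset.mem_filter] at h
      simp [Finset.insert_erase h.2.1]
  have heven : Even (∑ W ∈ rooms, #{x ∈ W | (W.erase x).image c = Finset.univ.erase i₀}) := by
    refine Finset.even_sum _ fun W hW => ?_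
    obtain ⟨h1, h2⟩ := (Finset.mem_filter_univ _).1 hW
    exact even_card_removals c i₀ h1 (hcon W h1 h2)
  have hargmin : ∀ W ∈ doors, ∃ m, IsArgmin r W m := fun W hW => by
    obtain ⟨h1, -, -⟩ := (Finset.mem_filter_univ _).1 hW
    exact exists_isArgmin r (Finset.card_pos.1 (by omega))
  -- The outside door, which consists of slack points, is the only one with an odd count.
  let W₀ : Finset X := (Finset.univ.erase i₀).image s
  have hW₀card : #W₀ + 1 = Fintype.card I := by
    rw [Finset.card_image_of_injective _ hsinj, hcardErase]
  have hW₀dom : IsDominant r W₀ := by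
    intro y
    by_cases hy : ∃ k, k ≠ i₀ ∧ y = s k
    · obtain ⟨k, -, rfl⟩ := hy
      exact ⟨k, fun w _ => hs k w⟩
    · refine ⟨i₀, fun w hw => ?_⟩
      obtain ⟨j, hj, rfl⟩ := Finset.mem_image.1 hw
      by_cases hy₀ : y = s i₀
      · rw [hy₀]; exact hs _ _
      · refine (hs' i₀ j (Finset.ne_of_mem_erase hj).symm y fun k hk => ?_).le
        by_cases hk₀ : k = i₀
        · exact hy₀ (hk₀ ▸ hk)
        · exact hy ⟨k, hk₀, hk⟩
  have hW₀ : W₀ ∈ doors := by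
    refine (Finset.mem_filter_univ _).2 ⟨hW₀card, hW₀dom, ?_⟩
    rw [Finset.image_image, show c ∘ s = id from funext hc, Finset.image_id]
  have hone : #{x | x ∉ W₀ ∧ IsDominant r (insert x W₀)} = 1 := by
    obtain ⟨m, hm⟩ := hargmin W₀ hW₀
    have hms : ∀ i, i ≠ i₀ → m i = s i := fun i hi =>
      (hm.eq_of_le hr (Finset.mem_image_of_mem _ (Finset.mem_erase.2 ⟨hi, Finset.mem_univ _⟩))
        fun w _ => hs i w).symm
    obtain ⟨j, hj, hmj⟩ := Finset.mem_image.1 (hm i₀).1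
    have hj₀ : j ≠ i₀ := Finset.ne_of_mem_erase hj
    refine card_completions_eq_one hr hm hW₀dom hW₀card hj₀.symm (by rw [hms j hj₀, hmj])
      ⟨t₀, fun i hi => ?_⟩ (Set.eq_empty_of_forall_notMem fun y hy => ?_)
    · rw [hms i hi]
      exact lt_of_le_of_ne (hs _ _) fun h => ht₀ i (hr i h).symm
    · have hy₀ : r i₀ (s j) < r i₀ y := hmj ▸ hy i₀ hj₀.symm
      by_cases hyt : ∃ k, y = s k
      · obtain ⟨k, rfl⟩ := hyt
        by_cases hk₀ : k = i₀
        · exact (hs i₀ (s j)).not_gt (hk₀ ▸ hy₀)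
        by_cases hkj : k = j
        · exact lt_irrefl _ (hkj ▸ hy₀)
        · have := hy k hkj
          rw [hms k hk₀] at this
          exact lt_irrefl _ this
      · push Not at hyt
        exact (hs' i₀ j hj₀.symm y hyt).not_gt hy₀
  have htwo : ∀ W ∈ doors.erase W₀, Even #{x | x ∉ W ∧ IsDominant r (insert x W)} := by
    intro W hW
    obtain ⟨hne, hW⟩ := Finset.mem_erase.1 hW
    obtain ⟨m, hm⟩ := hargmin W hW
    obtain ⟨h1, h2, h3⟩ := (Finset.mem_filter_univ _).1 hW
    have ht : ∃ t ∈ W, ∀ k, t ≠ s k := by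
      by_contra! hslack
      refine hne (Finset.eq_of_subset_of_card_le (fun w hw => ?_) (by omega))
      obtain ⟨k, rfl⟩ := hslack w hw
      have := Finset.mem_image_of_mem c hw
      rw [hc, h3] at this
      exact Finset.mem_image_of_mem _ this
    obtain ⟨t, htW, ht⟩ := ht
    have hnonempty : ∀ k, (upperRegion r m k).Nonempty := fun k =>
      ⟨s k, fun i hi => ((hm i).2 t htW).trans_lt (hs' i k hi t ht)⟩
    have hninj : ¬ Function.Injective m := fun hinj => by
      have := Finset.card_image_of_injective Finset.univ hinj
      rw [hm.image_eq hr h2, Finset.card_univ] at this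
      omega
    simp only [Function.Injective, not_forall] at hninj
    obtain ⟨i₁, i₂, heq, hi⟩ := hninj
    rw [card_completions_eq_two hr hm h2 h1 hi heq (hnonempty _) (hnonempty _)]
    exact even_two
  rw [← hcount, ← Finset.add_sum_erase _ _ hW₀, hone] at heven
  have := Finset.even_sum _ htwo
  exact absurd ((Nat.even_add.1 heven).2 this) Nat.not_even_one

end Scarf
/-! ### The Knaster–Kuratowski–Mazurkiewicz theorem -/

section KKM

variable {I : Type*} [Fintype I] [Nontrivial I]

/-- The discrete form of the KKM theorem: Scarf's lemma for the points of the simplex with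
denominator `N`, ranked by their coordinates with ties broken arbitrarily. -/
lemma exists_grid_point_near (D : I → Set (I → ℝ))
    (hcover : ∀ θ ∈ stdSimplex ℝ I, ∃ i, θ ∈ D i) {N : ℕ} (hN : 0 < N) :
    ∃ θ ∈ stdSimplex ℝ I, ∀ i, θ i ≤ Fintype.card I / N ∨
      ∃ θ' ∈ D i, dist θ θ' ≤ Fintype.card I / N := by
  classical
  obtain ⟨j₀⟩ := (inferInstance : Nonempty I)
  have hN' : (0 : ℝ) < N := by exact_mod_cast hN
  let T := {t : I → ℕ // t ∈ Finset.piAntidiag (Finset.univ : Finset I) N}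
  have hT : ∀ t : T, ∑ i, t.1 i = N := fun t => (Finset.mem_piAntidiag.1 t.2).1
  have mkT : ∀ f : I → ℕ, ∑ i, f i = N → ∃ t : T, t.1 = f := fun f hf =>
    ⟨⟨f, Finset.mem_piAntidiag.2 ⟨hf, fun i _ => Finset.mem_univ i⟩⟩, rfl⟩
  let θ : T → I → ℝ := fun t i => t.1 i / N
  have hθ : ∀ t, θ t ∈ stdSimplex ℝ I := fun t => by
    refine ⟨fun i => by positivity, ?_⟩
    have h : ((∑ i, t.1 i : ℕ) : ℝ) = N := by rw [hT]
    simp only [θ]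
    rw [← Finset.sum_div, ← Nat.cast_sum, h, div_self hN'.ne']
  choose c hc using fun t => hcover (θ t) (hθ t)
  let base : I → T ⊕ I → ℕ := fun i =>
    Sum.elim (fun t => t.1 i + 1) (fun j => if j = i then 0 else N + 2)
  let e := Fintype.equivFin (T ⊕ I)
  let r : I → T ⊕ I → ℕ ×ₗ Fin (Fintype.card (T ⊕ I)) := fun i x => toLex (base i x, e x)
  have hr : ∀ i, Function.Injective (r i) := fun i x y h =>
    e.injective (congrArg Prod.snd (toLex.injective h))
  have hlt : ∀ i x y, base i x < base i y → r i x < r i y := fun i x y h =>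
    Prod.Lex.toLex_lt_toLex.2 (Or.inl h)
  have hle : ∀ i x y, r i x ≤ r i y → base i x ≤ base i y := fun i x y h =>
    not_lt.1 fun h' => (hlt i y x h').not_ge h
  have hcoord : ∀ (t : T) i, t.1 i ≤ N := fun t i =>
    (Finset.single_le_sum (fun _ _ => Nat.zero_le _) (Finset.mem_univ i)).trans_eq (hT t)
  obtain ⟨t₀, -⟩ := mkT (Pi.single j₀ N) (by simp)
  obtain ⟨W, -, hdom, himg⟩ := exists_isDominant_image_eq_univ hr Sum.inr
    (fun i y => by
      by_cases hy : y = Sum.inr i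
      · rw [hy]
      · refine (hlt _ _ _ ?_).le
        rcases y with t | j
        · simp [base]
        · have : j ≠ i := fun h => hy (h ▸ rfl)
          simp [base, this])
    (fun i j hij t ht => by
      rcases t with t | k
      · refine hlt _ _ _ ?_
        have := hcoord t i
        simp only [base, Sum.elim_inl, Sum.elim_inr, if_neg hij.symm]
        omega
      · exact absurd rfl (ht k))
    (Sum.inl t₀) (fun k => Sum.inl_ne_inr) (Sum.elim c id) (fun i => rfl)
  have hcolour : ∀ i, Sum.inr i ∈ W ∨ ∃ t, Sum.inl t ∈ W ∧ c t = i := fun i => by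
    obtain ⟨w, hw, hwi⟩ := Finset.mem_image.1 (himg ▸ Finset.mem_univ i)
    rcases w with t | j
    · exact Or.inr ⟨t, hw, hwi⟩
    · exact Or.inl ((show j = i from hwi) ▸ hw)
  have hnotle : ∀ (t : T) i, Sum.inr i ∈ W → ¬ ∀ w ∈ W, r i (Sum.inl t) ≤ r i w :=
    fun t i hi h => by
      have := hle _ _ _ (h _ hi)
      simp [base] at this
  let σ : Finset T := {t | Sum.inl t ∈ W}
  have hσmem : ∀ t, t ∈ σ ↔ Sum.inl t ∈ W := fun t => Finset.mem_filter_univ t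
  have hσ : σ.Nonempty := by
    obtain ⟨i, hi⟩ := hdom (Sum.inl t₀)
    rcases hcolour i with h | ⟨t, ht, -⟩
    · exact absurd hi (hnotle t₀ i h)
    · exact ⟨t, (hσmem t).2 ht⟩
  choose μ hμσ hμ using fun i => σ.exists_min_image (fun t => t.1 i) hσ
  -- `ν` bounds the points of the dominant set from below and has nearly the full sum `N`.
  let ν : I → ℕ := fun i => if Sum.inr i ∈ W then 0 else (μ i).1 i
  have hν : ∀ t ∈ σ, ∀ i, ν i ≤ t.1 i := fun t ht i => by
    by_cases h : Sum.inr i ∈ W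
    · simp [ν, h]
    · simpa [ν, h] using hμ i t ht
  have hsum : N < ∑ i, (ν i + 1) := by
    by_contra! hcon
    obtain ⟨y, hy⟩ := mkT
      (fun i => ν i + 1 + Pi.single (M := fun _ => ℕ) j₀ (N - ∑ i, (ν i + 1)) i) (by
      rw [Finset.sum_add_distrib, Finset.sum_pi_single' j₀]
      simp only [Finset.mem_univ, if_true]
      omega)
    have hyν : ∀ i, ν i + 1 ≤ y.1 i := fun i => by rw [hy]; exact Nat.le_add_right _ _
    obtain ⟨i, hi⟩ := hdom (Sum.inl y)
    by_cases h : Sum.inr i ∈ W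
    · exact hnotle y i h hi
    · have h1 := hle _ _ _ (hi _ ((hσmem _).1 (hμσ i)))
      have h2 := hyν i
      simp only [base, Sum.elim_inl, ν, if_neg h] at h1 h2
      omega
  have hupper : ∀ t ∈ σ, ∀ i, t.1 i ≤ ν i + Fintype.card I := fun t ht i => by
    have h1 : ∑ j, (t.1 j - ν j) + ∑ j, ν j = N := by
      rw [← Finset.sum_add_distrib]
      exact (Finset.sum_congr rfl fun j _ => Nat.sub_add_cancel (hν t ht j)).trans (hT t)
    have h2 : t.1 i - ν i ≤ ∑ j, (t.1 j - ν j) :=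
      Finset.single_le_sum (f := fun j => t.1 j - ν j) (fun _ _ => Nat.zero_le _)
        (Finset.mem_univ i)
    rw [Finset.sum_add_distrib, Finset.sum_const, smul_eq_mul, mul_one, Finset.card_univ] at hsum
    omega
  obtain ⟨t, ht⟩ := hσ
  refine ⟨θ t, hθ t, fun i => ?_⟩
  by_cases h : Sum.inr i ∈ W
  · left
    have := hupper t ht i
    simp only [ν, if_pos h, zero_add] at this
    have : (t.1 i : ℝ) ≤ Fintype.card I := by exact_mod_cast this
    exact div_le_div_of_nonneg_right this hN'.le
  · right
    obtain ⟨t', ht', rfl⟩ := (hcolour i).resolve_left h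
    refine ⟨θ t', hc t', (dist_pi_le_iff (by positivity)).2 fun k => ?_⟩
    have h1 := hν t ht k
    have h2 := hν t' ((hσmem t').2 ht') k
    have h3 := hupper t ht k
    have h4 := hupper t' ((hσmem t').2 ht') k
    have h5 : (t.1 k : ℝ) ≤ t'.1 k + Fintype.card I := by
      exact_mod_cast (show t.1 k ≤ t'.1 k + Fintype.card I by omega)
    have h6 : (t'.1 k : ℝ) ≤ t.1 k + Fintype.card I := by
      exact_mod_cast (show t'.1 k ≤ t.1 k + Fintype.card I by omega)
    simp only [θ]
    rw [Real.dist_eq, ← sub_div, abs_div, abs_of_pos hN']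
    refine div_le_div_of_nonneg_right (abs_le.2 ⟨?_, ?_⟩) hN'.le <;> linarith

/-- The **KKM theorem**, in its facet version: closed sets that cover a simplex and contain
one facet each have a common point. -/
theorem exists_mem_stdSimplex_forall_mem (D : I → Set (I → ℝ)) (hclosed : ∀ i, IsClosed (D i))
    (hcover : ∀ θ ∈ stdSimplex ℝ I, ∃ i, θ ∈ D i)
    (hfacet : ∀ θ ∈ stdSimplex ℝ I, ∀ i, θ i = 0 → θ ∈ D i) :
    ∃ θ ∈ stdSimplex ℝ I, ∀ i, θ ∈ D i := by
  classical
  choose! θ hθ hnear using fun (N : ℕ) (hN : 0 < N) => exists_grid_point_near D hcover hN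
  obtain ⟨θ₀, hθ₀, φ, hφ, hlim⟩ := (isCompact_stdSimplex ℝ I).tendsto_subseq
    (x := fun N => θ (N + 1)) fun N => hθ _ N.succ_pos
  have hne : ∀ i, (D i).Nonempty := fun i => by
    obtain ⟨j, hj⟩ := exists_ne i
    exact ⟨_, hfacet _ (single_mem_stdSimplex ℝ j) i (by simp [hj.symm])⟩
  refine ⟨θ₀, hθ₀, fun i => ?_⟩
  let g : (I → ℝ) → ℝ := fun θ => min (θ i) (Metric.infDist θ (D i))
  have hg : Continuous g := (continuous_apply i).min (Metric.continuous_infDist_pt _)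
  have hbound : ∀ N, g (θ (N + 1)) ≤ Fintype.card I / ((N + 1 : ℕ) : ℝ) := fun N => by
    rcases hnear (N + 1) N.succ_pos i with h | ⟨θ', hθ', h⟩
    · exact (min_le_left _ _).trans h
    · exact (min_le_right _ _).trans ((Metric.infDist_le_dist_of_mem hθ').trans h)
  have hzero : Filter.Tendsto (fun N : ℕ => (Fintype.card I : ℝ) / ((N + 1 : ℕ) : ℝ))
      Filter.atTop (nhds 0) :=
    (tendsto_const_div_atTop_nhds_zero_nat _).comp (Filter.tendsto_add_atTop_nat 1)
  have hle : g θ₀ ≤ 0 := le_of_tendsto_of_tendsto ((hg.tendsto θ₀).comp hlim)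
    (hzero.comp hφ.tendsto_atTop) (Filter.Eventually.of_forall fun n => hbound (φ n))
  rcases min_le_iff.1 hle with h | h
  · exact hfacet θ₀ hθ₀ i (le_antisymm h (hθ₀.1 i))
  · exact ((hclosed i).mem_iff_infDist_zero (hne i)).2 (le_antisymm h Metric.infDist_nonneg)

end KKM

/-! ### Families of quadratic functions -/

/-- A family of quadratic functions on `E` that depends linearly on a parameter in `X`; the
bilinear part need not be symmetric. -/
structure QuadFamily (X E : Type*) [NormedAddCommGroup X] [NormedSpace ℝ X]
    [NormedAddCommGroup E] [NormedSpace ℝ E] where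
  /-- The bilinear part. -/
  bil : X →L[ℝ] E →L[ℝ] E →L[ℝ] ℝ
  /-- The linear part. -/
  lin : X →L[ℝ] E →L[ℝ] ℝ
  /-- The constant part. -/
  const : X →L[ℝ] ℝ

/-- Points that lie in no common affine hyperplane. -/
def AffinelySpanning {ι E : Type*} [NormedAddCommGroup E] [NormedSpace ℝ E] (p : ι → E) : Prop :=
  ∀ (ℓ : E →L[ℝ] ℝ) (c : ℝ), (∀ i, ℓ (p i) = c) → ℓ = 0

namespace QuadFamily

variable {X E : Type*} [NormedAddCommGroup X] [NormedSpace ℝ X]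
  [NormedAddCommGroup E] [InnerProductSpace ℝ E] (F : QuadFamily X E)

/-- The value at `y` of the quadratic function with parameter `x`. -/
noncomputable def eval (x : X) (y : E) : ℝ := F.bil x y y + F.lin x y + F.const x

/-- The quadratic function with parameter `x`, plus the squared distance to `c`. -/
noncomputable def gap (c : E) (x : X) (y : E) : ℝ := ‖y - c‖ ^ 2 + F.eval x y

lemma eval_add (x x' : X) (y : E) : F.eval (x + x') y = F.eval x y + F.eval x' y := by
  simp [eval]; ring

lemma eval_smul (s : ℝ) (x : X) (y : E) : F.eval (s • x) y = s * F.eval x y := by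
  simp [eval]; ring

lemma eval_zero (y : E) : F.eval 0 y = 0 := by simp [eval]

lemma continuous_eval (y : E) : Continuous fun x => F.eval x y := by
  unfold eval; fun_prop

lemma continuous_gap (c y : E) : Continuous fun x => F.gap c x y :=
  continuous_const.add (F.continuous_eval y)

set_option maxSynthPendingDepth 3 in
lemma exists_bil_bound : ∃ b, 0 ≤ b ∧ ∀ x z w, |F.bil x z w| ≤ b * ‖x‖ * ‖z‖ * ‖w‖ :=
  ⟨‖F.bil‖, norm_nonneg _, fun x z w => (ContinuousLinearMap.le_opNorm₂ (F.bil x) z w).trans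
    (by gcongr; exact F.bil.le_opNorm x)⟩

set_option maxSynthPendingDepth 3 in
lemma exists_lin_bound : ∃ l, 0 ≤ l ∧ ∀ x z, |F.lin x z| ≤ l * ‖x‖ * ‖z‖ :=
  ⟨‖F.lin‖, norm_nonneg _, fun x z => F.lin.le_opNorm₂ x z⟩

lemma eval_add_smul (x : X) (y z : E) (t : ℝ) : F.eval x (y + t • z) =
    F.eval x y + t * (F.bil x y z + F.bil x z y + F.lin x z) + t ^ 2 * F.bil x z z := by
  simp [eval]; ring

lemma gap_add_smul (c : E) (x : X) (z : E) (t : ℝ) : F.gap c x (c + t • z) =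
    F.eval x c + t * (F.bil x c z + F.bil x z c + F.lin x z) +
      t ^ 2 * (‖z‖ ^ 2 + F.bil x z z) := by
  rw [gap, eval_add_smul, add_sub_cancel_left, norm_smul, mul_pow, Real.norm_eq_abs, sq_abs]
  ring

/-- Sublevel sets of `gap` vary semicontinuously with the parameter where `gap` is strictly
convex: the minimum cannot be lost to infinity. -/
lemma exists_gap_le_of_tendsto [FiniteDimensional ℝ E] {c : E} {x : ℕ → X} {x₀ : X} {y : ℕ → E}
    {s : ℝ} (hx : Filter.Tendsto x Filter.atTop (nhds x₀)) (h : ∀ n, F.gap c (x n) (y n) ≤ s)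
    (hpos : ∀ z ≠ 0, 0 < ‖z‖ ^ 2 + F.bil x₀ z z) : ∃ y₀, F.gap c x₀ y₀ ≤ s := by
  -- Homogenize, so that the points `(y n, 1)` can be normalized to lie on a sphere.
  let H : X × E × ℝ → ℝ := fun v => ‖v.2.1 - v.2.2 • c‖ ^ 2 + F.bil v.1 v.2.1 v.2.1 +
    v.2.2 * F.lin v.1 v.2.1 + v.2.2 ^ 2 * F.const v.1
  have hH : Continuous H := by fun_prop
  have hHsmul : ∀ x y (t r : ℝ), H (x, r • y, r * t) = r ^ 2 * H (x, y, t) := fun x y t r => by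
    simp only [H, mul_smul, ← smul_sub, norm_smul, mul_pow, Real.norm_eq_abs, sq_abs, map_smul,
      smul_apply, smul_eq_mul]
    ring
  have hHone : ∀ x y, H (x, y, 1) = F.gap c x y := fun x y => by
    simp only [H, gap, eval, one_smul]; ring
  have hnorm : ∀ n, 0 < ‖(y n, (1 : ℝ))‖ := fun n => norm_pos_iff.2 fun h =>
    one_ne_zero (congrArg Prod.snd h)
  obtain ⟨w, hw, φ, hφ, hlim⟩ := (isCompact_sphere (0 : E × ℝ) 1).tendsto_subseq
    (x := fun n => ‖(y n, (1 : ℝ))‖⁻¹ • (y n, (1 : ℝ))) fun n => by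
      rw [mem_sphere_zero_iff_norm, norm_smul, norm_inv, norm_norm, inv_mul_cancel₀ (hnorm n).ne']
  have hle : H (x₀, w) ≤ w.2 ^ 2 * s := by
    refine le_of_tendsto_of_tendsto' ((hH.tendsto (x₀, w)).comp
      ((hx.comp hφ.tendsto_atTop).prodMk_nhds hlim))
      ((((continuous_snd.tendsto w).comp hlim).pow 2).mul_const s) fun n => ?_
    have := hHsmul (x (φ n)) (y (φ n)) 1 ‖(y (φ n), (1 : ℝ))‖⁻¹
    simp only [Function.comp_apply, Prod.smul_mk, smul_eq_mul] at this ⊢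
    rw [this, hHone, mul_one]
    exact mul_le_mul_of_nonneg_left (h _) (sq_nonneg _)
  obtain ⟨z, t⟩ := w
  have ht : t ≠ 0 := by
    rintro rfl
    have hz : z ≠ 0 := by
      rintro rfl
      simp at hw
    have := hpos z hz
    simp only [H, zero_smul, sub_zero] at hle
    linarith
  refine ⟨t⁻¹ • z, ?_⟩
  have := hHsmul x₀ z t t⁻¹
  rw [inv_mul_cancel₀ ht, hHone] at this
  rw [this, inv_pow, inv_mul_le_iff₀ (by positivity)]
  exact hle

/-- The parameters for which all the functions `gap (q j)` are bounded below by `-δ`. -/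
def slab {J : Type*} (q : J → E) (δ : ℝ) : Set X := {x | ∀ j y, -δ ≤ F.gap (q j) x y}

section Slab

variable {J : Type*} (q : J → E)

lemma slab_mono {δ δ' : ℝ} (h : δ ≤ δ') : F.slab q δ ⊆ F.slab q δ' :=
  fun _ hx j y => (neg_le_neg h).trans (hx j y)

lemma isClosed_slab (δ : ℝ) : IsClosed (F.slab q δ) := by
  simp only [slab, Set.ofPred_forall]
  exact isClosed_iInter fun j => isClosed_iInter fun y =>
    isClosed_le continuous_const (F.continuous_gap _ _)

lemma convex_slab (δ : ℝ) : Convex ℝ (F.slab q δ) := by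
  intro x hx x' hx' a b ha hb hab j y
  have h1 := mul_le_mul_of_nonneg_left (hx j y) ha
  have h2 := mul_le_mul_of_nonneg_left (hx' j y) hb
  have h3 : F.gap (q j) (a • x + b • x') y = a * F.gap (q j) x y + b * F.gap (q j) x' y := by
    simp only [gap, eval_add, eval_smul]
    linear_combination (-‖y - q j‖ ^ 2) * hab
  rw [h3]
  calc -δ = a * -δ + b * -δ := by rw [← add_mul, hab, one_mul]
    _ ≤ _ := add_le_add h1 h2

lemma slab_mem_nhds [Finite J] [FiniteDimensional ℝ E] {δ : ℝ} {x : X}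
    (hpos : ∀ z ≠ 0, 0 < ‖z‖ ^ 2 + F.bil x z z) (hx : ∀ j y, -δ < F.gap (q j) x y) :
    F.slab q δ ∈ nhds x := by
  refine Filter.eventually_all.2 fun j => ?_
  by_contra hcon
  obtain ⟨x', hx', hlt⟩ := Filter.exists_seq_forall_of_frequently (Filter.not_eventually.1 hcon)
  simp only [not_forall, not_le] at hlt
  choose y hy using hlt
  obtain ⟨y₀, hy₀⟩ := F.exists_gap_le_of_tendsto hx' (fun n => (hy n).le) hpos
  exact absurd (hx j y₀) hy₀.not_gt

end Slab

/-- A real quadratic polynomial that is bounded below has a nonnegative leading coefficient, and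
a zero linear coefficient if the leading coefficient vanishes. -/
lemma coeff_of_bounded_below {a b c : ℝ} (h : ∀ t : ℝ, 0 ≤ c + t * b + t ^ 2 * a) :
    0 ≤ a ∧ (a = 0 → b = 0) := by
  have hd : discrim a b c ≤ 0 := discrim_le_zero fun t => by nlinarith [h t]
  have hc : 0 ≤ c := by simpa using h 0
  have ha : 0 ≤ a := by
    by_contra! hneg
    have h1 := h ((1 + |b| + c) / -a + 1)
    have h2 := h (-((1 + |b| + c) / -a + 1))
    have h3 : 0 ≤ (1 + |b| + c) / -a := div_nonneg (by positivity) (by linarith)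
    have h4 : (1 + |b| + c) / -a * a = -(1 + |b| + c) := by
      rw [div_neg, neg_mul, div_mul_cancel₀ _ hneg.ne]
    nlinarith [abs_nonneg b]
  refine ⟨ha, fun h0 => ?_⟩
  rw [discrim, h0] at hd
  nlinarith [sq_nonneg b]

/-- On a slab the quadratic part of `gap` is positive definite: along a null direction each
`gap (q j)` would have to be constant, which makes a bilinear form constant on the spanning
points `q j`. -/
lemma pos_of_mem_slab {J : Type*} {q : J → E} (hq : AffinelySpanning q) {δ : ℝ} {x : X}
    (hx : x ∈ F.slab q δ) [Nonempty J] (z : E) (hz : z ≠ 0) : 0 < ‖z‖ ^ 2 + F.bil x z z := by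
  have key := fun j => coeff_of_bounded_below (c := F.eval x (q j) + δ)
    (b := F.bil x (q j) z + F.bil x z (q j) + F.lin x z) (a := ‖z‖ ^ 2 + F.bil x z z) fun t => by
      have := hx j (q j + t • z)
      rw [gap_add_smul] at this
      linarith
  obtain ⟨j₀⟩ := (inferInstance : Nonempty J)
  refine lt_of_le_of_ne (key j₀).1 fun h0 => ?_
  have hℓ := hq ((F.bil x).flip z + F.bil x z) (-F.lin x z) fun j => by
    have := (key j).2 h0.symm
    simp only [add_apply, ContinuousLinearMap.flip_apply]
    linarith
  have hzz := congrArg (fun ℓ => ℓ z) hℓ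
  simp only [add_apply, ContinuousLinearMap.flip_apply,
    zero_apply] at hzz
  have : 0 < ‖z‖ ^ 2 := by positivity
  linarith

/-! ### Quadratic functions that vanish on one set of points and are free on another -/

variable {I J : Type*} {p : I → E} {q : J → E}

/-- A family, parametrized by `J → ℝ`, of quadratic functions that vanish at the points `p i` and
take the value `x j` at the point `q j`. -/
structure Interpolates [Fintype J] (F : QuadFamily (J → ℝ) E) (p : I → E) (q : J → E) : Prop where
  eval_left : ∀ x i, F.eval x (p i) = 0
  eval_right : ∀ x j, F.eval x (q j) = x j

variable [Fintype J] {F : QuadFamily (J → ℝ) E}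

lemma Interpolates.eq_zero (hF : F.Interpolates p q) (hp : AffinelySpanning p) [Nonempty I]
    {x : J → ℝ} (h : ∀ z, F.bil x z z = 0) : x = 0 := by
  have hlin : F.lin x = 0 := hp _ (-F.const x) fun i => by
    have := hF.eval_left x i
    rw [eval, h] at this
    linarith
  obtain ⟨i⟩ := (inferInstance : Nonempty I)
  have hconst : F.const x = 0 := by
    have := hF.eval_left x i
    rw [eval, h, hlin] at this
    simpa using this
  ext j
  rw [← hF.eval_right x j, eval, h, hlin, hconst]
  simp

/-- A limit at infinity of a slab would be a nonnegative quadratic function that vanishes, hence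
is critical, at the spanning points `p i`. -/
lemma Interpolates.isCompact_slab (hF : F.Interpolates p q) (hp : AffinelySpanning p) [Nonempty I]
    [Nonempty J] (δ : ℝ) : IsCompact (F.slab q δ) := by
  refine Metric.isCompact_of_isClosed_isBounded (F.isClosed_slab q δ) ?_
  by_contra hunb
  rw [isBounded_iff_forall_norm_le] at hunb
  push Not at hunb
  choose x hx hnorm using fun n : ℕ => hunb (n + 1)
  have hpos : ∀ n, 0 < ‖x n‖ := fun n => lt_trans (by positivity) (hnorm n)
  have hinv : Filter.Tendsto (fun n => ‖x n‖⁻¹) Filter.atTop (nhds 0) := by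
    refine tendsto_inv_atTop_zero.comp (Filter.tendsto_atTop_mono (fun n => (hnorm n).le) ?_)
    exact Filter.tendsto_atTop_add_const_right _ _ tendsto_natCast_atTop_atTop
  obtain ⟨v, hv, φ, hφ, hlim⟩ := (isCompact_sphere (0 : J → ℝ) 1).tendsto_subseq
    (x := fun n => ‖x n‖⁻¹ • x n) fun n => by
      rw [mem_sphere_zero_iff_norm, norm_smul, norm_inv, norm_norm, inv_mul_cancel₀ (hpos n).ne']
  obtain ⟨j⟩ := (inferInstance : Nonempty J)
  have hnonneg : ∀ y, 0 ≤ F.eval v y := fun y => by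
    have h1 := (hinv.comp hφ.tendsto_atTop).mul_const (-δ - ‖y - q j‖ ^ 2)
    rw [zero_mul] at h1
    refine le_of_tendsto_of_tendsto' h1 (((F.continuous_eval y).tendsto v).comp hlim) fun n => ?_
    simp only [Function.comp_apply, eval_smul]
    refine mul_le_mul_of_nonneg_left ?_ (inv_nonneg.2 (norm_nonneg _))
    have := hx (φ n) j y
    rw [gap] at this
    linarith
  have hcrit : ∀ i z, F.bil v (p i) z + F.bil v z (p i) + F.lin v z = 0 := fun i z => by
    have := discrim_le_zero (a := F.bil v z z)
      (b := F.bil v (p i) z + F.bil v z (p i) + F.lin v z) (c := 0) fun t => by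
        have := hnonneg (p i + t • z)
        rw [eval_add_smul, hF.eval_left] at this
        linarith
    rw [discrim] at this
    nlinarith [sq_nonneg (F.bil v (p i) z + F.bil v z (p i) + F.lin v z)]
  have hzero : v = 0 := hF.eq_zero hp fun z => by
    have hℓ := hp ((F.bil v).flip z + F.bil v z) (-F.lin v z) fun i => by
      have := hcrit i z
      simp only [add_apply, ContinuousLinearMap.flip_apply]
      linarith
    have hzz := congrArg (fun ℓ => ℓ z) hℓ
    simp only [add_apply, ContinuousLinearMap.flip_apply,
      zero_apply] at hzz
    linarith
  rw [hzero] at hv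
  simp at hv

/-- The KKM theorem, applied to the radial projection of the simplex to the boundary of a slab. -/
lemma Interpolates.exists_mem_slab [FiniteDimensional ℝ E] (hF : F.Interpolates p q)
    (hp : AffinelySpanning p) (hq : AffinelySpanning q) [Nonempty I] [Nontrivial J] {δ : ℝ}
    (hδ : 0 < δ) :
    ∃ x ∈ F.slab q δ, x ≠ 0 ∧ (∀ j, 0 ≤ x j) ∧ ∀ j, ∃ y, F.gap (q j) x y ≤ 0 := by
  have hconv := F.convex_slab q δ
  have hnhds : F.slab q δ ∈ nhds 0 := by
    refine F.slab_mem_nhds q (fun z hz => ?_) fun j y => ?_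
    · simpa using pow_pos (norm_pos_iff.2 hz) 2
    · rw [gap, eval_zero]
      nlinarith [sq_nonneg ‖y - q j‖]
  have hcpt := hF.isCompact_slab hp δ
  have hgpos : ∀ θ ∈ stdSimplex ℝ J, 0 < gauge (F.slab q δ) θ := fun θ hθ => by
    refine (gauge_pos (absorbent_nhds_zero hnhds)
      (NormedSpace.isVonNBounded_of_isBounded ℝ hcpt.isBounded)).2 ?_
    rintro rfl
    simpa using hθ.2
  have hgcont : Continuous (gauge (F.slab q δ)) := continuous_gauge hconv hnhds
  let R : (J → ℝ) → J → ℝ := fun θ => (gauge (F.slab q δ) θ)⁻¹ • θ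
  have hRone : ∀ θ ∈ stdSimplex ℝ J, gauge (F.slab q δ) (R θ) = 1 := fun θ hθ => by
    rw [gauge_smul_of_nonneg (inv_nonneg.2 (gauge_nonneg _)), smul_eq_mul,
      inv_mul_cancel₀ (hgpos θ hθ).ne']
  have hRmem : ∀ θ ∈ stdSimplex ℝ J, R θ ∈ F.slab q δ := fun θ hθ => by
    rw [← (F.isClosed_slab q δ).closure_eq, ← gauge_le_one_iff_mem_closure hconv hnhds]
    exact (hRone θ hθ).le
  have hRpos : ∀ θ ∈ stdSimplex ℝ J, ∀ z ≠ 0, 0 < ‖z‖ ^ 2 + F.bil (R θ) z z := fun θ hθ =>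
    F.pos_of_mem_slab hq (hRmem θ hθ)
  obtain ⟨θ, hθ, hmem⟩ := exists_mem_stdSimplex_forall_mem
    (fun j => {θ | θ ∈ stdSimplex ℝ J ∧ ∃ y, F.gap (q j) (R θ) y ≤ 0})
    (fun j => IsSeqClosed.isClosed fun θ θ₀ hθ hlim => by
      have hθ₀ : θ₀ ∈ stdSimplex ℝ J :=
        (isClosed_stdSimplex ℝ J).mem_of_tendsto hlim
          (Filter.Eventually.of_forall fun n => (hθ n).1)
      choose y hy using fun n => (hθ n).2
      have hR : Filter.Tendsto (fun n => R (θ n)) Filter.atTop (nhds (R θ₀)) :=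
        (((hgcont.tendsto θ₀).comp hlim).inv₀ (hgpos θ₀ hθ₀).ne').smul hlim
      exact ⟨hθ₀, F.exists_gap_le_of_tendsto hR hy (hRpos θ₀ hθ₀)⟩)
    (fun θ hθ => by
      by_contra! hcon
      have hint : R θ ∈ interior (F.slab q δ) := by
        refine mem_interior_iff_mem_nhds.2 (F.slab_mem_nhds q (hRpos θ hθ) fun j y => ?_)
        have : ¬ F.gap (q j) (R θ) y ≤ 0 := fun h => hcon j ⟨hθ, y, h⟩
        linarith
      exact ((gauge_lt_one_iff_mem_interior hconv hnhds).2 hint).ne (hRone θ hθ))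
    (fun θ hθ j hj => ⟨hθ, q j, by
      rw [gap, hF.eval_right, sub_self, norm_zero]
      simp [R, hj]⟩)
  refine ⟨R θ, hRmem θ hθ, fun h => ?_, fun j => ?_, fun j => (hmem j).2⟩
  · have := hRone θ hθ
    rw [h, gauge_zero] at this
    exact zero_ne_one this
  · exact mul_nonneg (inv_nonneg.2 (gauge_nonneg _)) (hθ.1 j)

/-- Near `0` the minimum of `gap (q j)` is `x j` up to a term of second order in `x`, so the
minima cannot all be nonpositive for a small nonnegative `x`. -/
lemma Interpolates.exists_norm_lower_bound (hF : F.Interpolates p q) [Nonempty J] :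
    ∃ c > 0, ∀ x : J → ℝ, x ≠ 0 → (∀ j, 0 ≤ x j) → (∀ j, ∃ y, F.gap (q j) x y ≤ 0) →
      c ≤ ‖x‖ := by
  obtain ⟨C, hC1, hbil, hlin⟩ : ∃ C : ℝ, 1 ≤ C ∧ (∀ x z, -(C * ‖x‖ * ‖z‖ ^ 2) ≤ F.bil x z z) ∧
      ∀ x j z, -(C * ‖x‖ * ‖z‖) ≤ F.bil x (q j) z + F.bil x z (q j) + F.lin x z := by
    obtain ⟨M, hM⟩ := Finite.exists_le fun j => ‖q j‖
    have hM0 : 0 ≤ M := (norm_nonneg _).trans (hM (Classical.arbitrary J))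
    obtain ⟨b, hb0, hb⟩ := F.exists_bil_bound
    obtain ⟨l, hl0, hl⟩ := F.exists_lin_bound
    refine ⟨1 + b + 2 * b * M + l, ?_, fun x z => ?_, fun x j z => ?_⟩
    · have : 0 ≤ 2 * b * M := by positivity
      linarith
    · have h1 := (abs_le.1 (hb x z z)).1
      have h2 : 0 ≤ (1 + 2 * b * M + l) * (‖x‖ * ‖z‖ ^ 2) := by positivity
      linarith
    · have h1 := (abs_le.1 (hb x (q j) z)).1
      have h2 := (abs_le.1 (hb x z (q j))).1
      have h3 := (abs_le.1 (hl x z)).1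
      have h4 : b * ‖x‖ * ‖z‖ * ‖q j‖ ≤ b * ‖x‖ * ‖z‖ * M := by
        gcongr; exact hM j
      have h5 : 0 ≤ (1 + b) * (‖x‖ * ‖z‖) := by positivity
      linarith
  refine ⟨1 / (2 * C ^ 2), by positivity, fun x hx hx0 h => ?_⟩
  by_contra! hlt
  have hr : 0 < ‖x‖ := norm_pos_iff.2 hx
  have hCr : C ^ 2 * ‖x‖ < 1 / 2 := by
    rw [lt_div_iff₀ (by positivity)] at hlt
    linarith
  obtain ⟨j, hj⟩ : ∃ j, ‖x‖ = x j := by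
    obtain ⟨j, hj⟩ := Finite.exists_max x
    refine ⟨j, le_antisymm ((pi_norm_le_iff_of_nonneg (hx0 j)).2 fun k => ?_) ?_⟩
    · rw [Real.norm_of_nonneg (hx0 k)]; exact hj k
    · exact (le_abs_self _).trans (norm_le_pi_norm x j)
  obtain ⟨y, hy⟩ := h j
  have hgap := F.gap_add_smul (q j) x (y - q j) 1
  rw [one_smul, add_sub_cancel, hF.eval_right, ← hj] at hgap
  have h1 := hbil x (y - q j)
  have h2 := hlin x j (y - q j)
  set a := ‖y - q j‖
  set r := ‖x‖
  have hCr' : C * r ≤ 1 / 2 := by nlinarith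
  have h3 : C * r * a ^ 2 ≤ 1 / 2 * a ^ 2 := by gcongr
  have h4 : C ^ 2 * r * r < 1 / 2 * r := by gcongr
  nlinarith [sq_nonneg (a - C * r)]

/-- Besides `0` there is another parameter for which all the functions `gap (q j)` have minimum
`0`. -/
theorem Interpolates.exists_tight [FiniteDimensional ℝ E] (hF : F.Interpolates p q)
    (hp : AffinelySpanning p) (hq : AffinelySpanning q) [Nonempty I] [Nontrivial J] :
    ∃ x : J → ℝ, x ≠ 0 ∧ (∀ j y, 0 ≤ F.gap (q j) x y) ∧ ∀ j, ∃ y, F.gap (q j) x y = 0 := by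
  choose x hx hx0 hxnn hxy using fun n : ℕ =>
    hF.exists_mem_slab hp hq (Nat.one_div_pos_of_nat (α := ℝ) (n := n))
  obtain ⟨c, hc, hlow⟩ := hF.exists_norm_lower_bound
  have hδ : ∀ n : ℕ, 1 / ((n : ℝ) + 1) ≤ 1 := fun n => by
    rw [div_le_one (by positivity)]
    linarith [n.cast_nonneg (α := ℝ)]
  obtain ⟨v, hv, φ, hφ, hlim⟩ := (hF.isCompact_slab hp 1).tendsto_subseq
    fun n => F.slab_mono q (hδ n) (hx n)
  have hnonneg : ∀ j y, 0 ≤ F.gap (q j) v y := fun j y => by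
    have h0 := (tendsto_one_div_add_atTop_nhds_zero_nat (𝕜 := ℝ)).neg.comp hφ.tendsto_atTop
    rw [neg_zero] at h0
    exact le_of_tendsto_of_tendsto' h0 (((F.continuous_gap (q j) y).tendsto v).comp hlim)
      fun n => hx (φ n) j y
  refine ⟨v, fun h => ?_, hnonneg, fun j => ?_⟩
  · have : c ≤ ‖v‖ := ge_of_tendsto' ((continuous_norm.tendsto v).comp hlim) fun n =>
      hlow _ (hx0 _) (hxnn _) (hxy _)
    rw [h, norm_zero] at this
    exact this.not_gt hc
  · choose y hy using fun n => hxy (φ n) j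
    obtain ⟨y₀, hy₀⟩ := F.exists_gap_le_of_tendsto hlim hy (F.pos_of_mem_slab hq hv)
    exact ⟨y₀, le_antisymm hy₀ (hnonneg j y₀)⟩

end QuadFamily
/-! ### Generic points and polynomial functions -/

/-- Linearly independent functions have a nonzero evaluation determinant at suitable points. -/
lemma exists_det_ne_zero {S Y : Type*} [Fintype S] [DecidableEq S] (g : Y → S → ℝ)
    (h : ∀ c : S → ℝ, (∀ y, ∑ s, c s * g y s = 0) → c = 0) :
    ∃ y : S → Y, (Matrix.of fun s => g (y s)).det ≠ 0 := by
  have hspan : Submodule.span ℝ (Set.range g) = ⊤ := by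
    by_contra hne
    obtain ⟨f, hf, hle⟩ := Submodule.exists_le_ker_of_lt_top _ (lt_top_iff_ne_top.2 hne)
    have hfs : ∀ w : S → ℝ, f w = ∑ s, f (Pi.single s 1) * w s := fun w => by
      conv_lhs => rw [← Finset.univ_sum_single w, map_sum]
      refine Finset.sum_congr rfl fun s _ => ?_
      rw [mul_comm, ← smul_eq_mul, ← map_smul, ← Pi.single_smul, smul_eq_mul, mul_one]
    have hc := h (fun s => f (Pi.single s 1)) fun y => by
      rw [← hfs]
      exact hle (Submodule.subset_span ⟨y, rfl⟩)
    refine hf (LinearMap.ext fun w => ?_)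
    rw [hfs]
    simp [fun s => congrFun hc s]
  obtain ⟨b, hb, -, hlin⟩ := Submodule.exists_fun_fin_finrank_span_eq ℝ (Set.range g)
  have hcard : Fintype.card S = Module.finrank ℝ (Submodule.span ℝ (Set.range g)) := by
    rw [hspan, finrank_top, Module.finrank_fintype_fun_eq_card]
  choose y hy using hb
  let e := Fintype.equivFinOfCardEq hcard
  refine ⟨fun s => y (e s), ?_⟩
  have hrow : LinearIndependent ℝ (Matrix.of fun s => g (y (e s))).row := by
    have hb : (Matrix.of fun s => g (y (e s))).row = b ∘ e := funext fun s => hy (e s)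
    rw [hb]
    exact hlin.comp e e.injective
  exact ((Matrix.isUnit_iff_isUnit_det _).1
    (Matrix.linearIndependent_rows_iff_isUnit.1 hrow)).ne_zero

/-- A polynomial determinant in the coordinates of generic points is nonzero as soon as it is
nonzero at some real points. -/
lemma IsGeneric.det_ne_zero {V S : Type*} [Fintype S] [DecidableEq S] {d : ℕ}
    {p : V → EuclideanSpace ℝ (Fin d)} (hp : IsGeneric p) {e : S → V}
    (he : Function.Injective e) (f : S → MvPolynomial (Fin d) ℚ) (y : S → Fin d → ℝ)
    (hy : (Matrix.of fun s s' => MvPolynomial.aeval (y s) (f s')).det ≠ 0) :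
    (Matrix.of fun s s' => MvPolynomial.aeval (fun k => p (e s) k) (f s')).det ≠ 0 := by
  let M : Matrix S S (MvPolynomial (V × Fin d) ℚ) :=
    Matrix.of fun s s' => MvPolynomial.rename (fun k => (e s, k)) (f s')
  have hM : ∀ u : V × Fin d → ℝ, MvPolynomial.aeval u M.det =
      (Matrix.of fun s s' => MvPolynomial.aeval (fun k => u (e s, k)) (f s')).det := fun u => by
    rw [AlgHom.map_det]
    congr 1
    ext s s'
    simp only [M, AlgHom.mapMatrix_apply, Matrix.map_apply, Matrix.of_apply,
      MvPolynomial.aeval_rename]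
    rfl
  intro h0
  rw [← hM fun x => p x.1 x.2] at h0
  have hzero : M.det = 0 := AlgebraicIndependent.eq_zero_of_aeval_eq_zero hp _ h0
  have := hM fun x => Function.extend e y 0 x.1 x.2
  simp only [he.extend_apply] at this
  rw [hzero, map_zero] at this
  exact hy this.symm

/-- Homogeneous coordinates: the point `y` with an extra coordinate `1` in front. -/
def homog {R : Type*} [One R] {d : ℕ} (y : Fin d → R) : Fin (d + 1) → R := Fin.cons 1 y

lemma aeval_homog {d : ℕ} (y : Fin d → ℝ) (a : Fin (d + 1)) :
    MvPolynomial.aeval y (homog (MvPolynomial.X (R := ℚ)) a) = homog y a := by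
  refine Fin.cases ?_ (fun k => ?_) a <;> simp [homog]

lemma IsGeneric.affinelySpanning {ι : Type*} [Fintype ι] {d : ℕ}
    {p : ι → EuclideanSpace ℝ (Fin d)} (hp : IsGeneric p) (hcard : d + 1 ≤ Fintype.card ι) :
    AffinelySpanning p := by
  obtain ⟨e⟩ : Nonempty (Fin (d + 1) ↪ ι) :=
    Function.Embedding.nonempty_of_card_le (by simpa using hcard)
  obtain ⟨y, hy⟩ := exists_det_ne_zero (fun (y : Fin d → ℝ) => homog y) fun c hc => by
    have h0 : c 0 = 0 := by simpa [Fin.sum_univ_succ, homog] using hc 0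
    ext a
    refine Fin.cases h0 (fun k => ?_) a
    simpa [Fin.sum_univ_succ, homog, h0, Pi.single_apply] using hc (Pi.single k 1)
  have hdet := hp.det_ne_zero e.injective (homog MvPolynomial.X) y (by simpa [aeval_homog] using hy)
  simp only [aeval_homog] at hdet
  intro ℓ c hℓ
  have hsum : ∀ w : EuclideanSpace ℝ (Fin d), ℓ w = ∑ k, w k * ℓ (EuclideanSpace.single k 1) := by
    intro w
    conv_lhs => rw [← (EuclideanSpace.basisFun (Fin d) ℝ).sum_repr w, map_sum]
    simp
  have hker := Matrix.eq_zero_of_mulVec_eq_zero hdet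
    (v := Fin.cons (-c) fun k => ℓ (EuclideanSpace.single k 1)) (by
      ext a
      have := hℓ (e a)
      rw [hsum] at this
      simp [Matrix.mulVec, dotProduct, Fin.sum_univ_succ, homog, this])
  ext w
  rw [hsum]
  refine Finset.sum_eq_zero fun k _ => ?_
  have := congrFun hker k.succ
  simp only [Fin.cons_succ, Pi.zero_apply] at this
  rw [this, mul_zero]

/-- A quadratic form that vanishes on the affine chart `w 0 = 1` vanishes. -/
lemma bilinForm_self_eq_zero {d : ℕ} (B : LinearMap.BilinForm ℝ (Fin (d + 1) → ℝ))
    (h : ∀ w, w 0 = 1 → B w w = 0) (w : Fin (d + 1) → ℝ) : B w w = 0 := by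
  have hne : ∀ w : Fin (d + 1) → ℝ, w 0 ≠ 0 → B w w = 0 := fun w hw => by
    have := h ((w 0)⁻¹ • w) (by simp [hw])
    simpa [hw] using this
  by_cases hw : w 0 = 0
  · have h1 := hne (w + Pi.single 0 1) (by simp [hw])
    have h2 := hne (w - Pi.single 0 1) (by simp [hw])
    have h3 := hne (Pi.single 0 1) (by simp)
    simp only [map_add, map_sub, LinearMap.add_apply, LinearMap.sub_apply] at h1 h2
    linarith
  · exact hne w hw

/-- Indices for the monomials of degree two in the homogeneous coordinates of `ℝ^d`, that is, for
the monomials of degree at most two on `ℝ^d`. -/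
abbrev QuadIndex (d : ℕ) : Type := {s : Fin (d + 1) × Fin (d + 1) // s.1 ≤ s.2}

lemma card_quadIndex (d : ℕ) : Fintype.card (QuadIndex d) = (d + 2).choose 2 := by
  rw [← Fintype.card_congr Sym2.sortEquiv, Sym2.card, Fintype.card_fin]

lemma quadratic_monomials_independent {d : ℕ} (c : QuadIndex d → ℝ)
    (h : ∀ y : Fin d → ℝ, ∑ s, c s * (homog y s.1.1 * homog y s.1.2) = 0) : c = 0 := by
  let C : Matrix (Fin (d + 1)) (Fin (d + 1)) ℝ :=
    fun a b => if hab : a ≤ b then c ⟨(a, b), hab⟩ else 0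
  have hB : ∀ w, Matrix.toBilin' C w w = 0 := bilinForm_self_eq_zero _ fun w hw => by
    have hwy : w = homog (fun k => w k.succ) := by
      ext a; refine Fin.cases ?_ (fun k => ?_) a <;> simp [homog, hw]
    rw [← h fun k => w k.succ, ← hwy, Matrix.toBilin'_apply, ← Fintype.sum_prod_type']
    rw [← Finset.sum_filter_of_ne (p := fun x => x.1 ≤ x.2) fun x _ hx => by
      by_contra hle
      exact hx (by simp [C, hle])]
    rw [Finset.sum_subtype _ (p := fun x => x.1 ≤ x.2) (by simp)]
    refine Finset.sum_congr rfl fun s _ => ?_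
    simp only [C, dif_pos s.2]
    ring
  have hC : ∀ a b, C a b + C b a = 0 := fun a b => by
    have h1 := hB (Pi.single a 1 + Pi.single b 1)
    have h2 := hB (Pi.single a 1)
    have h3 := hB (Pi.single b 1)
    simp only [map_add, LinearMap.add_apply, Matrix.toBilin'_single] at h1 h2 h3
    linarith
  ext ⟨⟨a, b⟩, hab⟩
  have := hC a b
  rcases hab.eq_or_lt with heq | hlt
  · simp only at heq
    subst heq
    simp only [C, le_refl, dite_true] at this
    simp only [Pi.zero_apply]
    linarith
  · simp only at hlt
    simpa [C, hlt.le, hlt.not_ge] using this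

set_option maxSynthPendingDepth 3 in
/-- The space of quadratic functions on `ℝ^d` has dimension `(d + 2).choose 2`, so that as many
generic points impose independent conditions on it. -/
lemma IsGeneric.exists_interpolates {I J : Type*} [Fintype I] [Fintype J] {d : ℕ}
    {p : I ⊕ J → EuclideanSpace ℝ (Fin d)} (hp : IsGeneric p)
    (hcard : Fintype.card (I ⊕ J) = (d + 2).choose 2) :
    ∃ F : QuadFamily (J → ℝ) (EuclideanSpace ℝ (Fin d)),
      F.Interpolates (p ∘ Sum.inl) (p ∘ Sum.inr) := by
  classical
  let e : QuadIndex d ≃ I ⊕ J := Fintype.equivOfCardEq ((card_quadIndex d).trans hcard.symm)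
  obtain ⟨y, hy⟩ := exists_det_ne_zero
    (fun (y : Fin d → ℝ) (s : QuadIndex d) => homog y s.1.1 * homog y s.1.2)
    quadratic_monomials_independent
  have hdet := hp.det_ne_zero e.injective
    (fun s => homog MvPolynomial.X s.1.1 * homog MvPolynomial.X s.1.2) y
    (by simpa [aeval_homog] using hy)
  simp only [map_mul, aeval_homog] at hdet
  set M : Matrix (QuadIndex d) (QuadIndex d) ℝ := Matrix.of fun s s' =>
    homog (fun k => p (e s) k) s'.1.1 * homog (fun k => p (e s) k) s'.1.2 with hM
  -- `ℓ s x` is the coefficient at the monomial `s` of the quadratic function to be found.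
  let ℓ : QuadIndex d → (J → ℝ) →L[ℝ] ℝ := fun s =>
    ∑ j, M⁻¹ s (e.symm (Sum.inr j)) • ContinuousLinearMap.proj j
  let π : Fin (d + 1) → EuclideanSpace ℝ (Fin d) →L[ℝ] ℝ :=
    Fin.cons 0 fun k => EuclideanSpace.proj k
  let ε : Fin (d + 1) → ℝ := Fin.cons 1 0
  have hhomog : ∀ (y : EuclideanSpace ℝ (Fin d)) a, homog (fun k => y k) a = π a y + ε a :=
    fun y a => by refine Fin.cases ?_ (fun k => ?_) a <;> simp [homog, π, ε]
  let F : QuadFamily (J → ℝ) (EuclideanSpace ℝ (Fin d)) :=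
    { bil := ∑ s : QuadIndex d, (ℓ s).smulRight ((π s.1.1).smulRight (π s.1.2))
      lin := ∑ s : QuadIndex d, (ℓ s).smulRight (ε s.1.2 • π s.1.1 + ε s.1.1 • π s.1.2)
      const := ∑ s : QuadIndex d, (ε s.1.1 * ε s.1.2) • ℓ s }
  have hF : ∀ x y, F.eval x y =
      ∑ s, ℓ s x * (homog (fun k => y k) s.1.1 * homog (fun k => y k) s.1.2) := fun x y => by
    simp only [QuadFamily.eval, F, hhomog, sum_apply,
      ContinuousLinearMap.smulRight_apply, smul_apply, add_apply,
      smul_eq_mul, ← Finset.sum_add_distrib]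
    exact Finset.sum_congr rfl fun s _ => by ring
  have hval : ∀ x v, F.eval x (p v) = Sum.elim (fun _ => 0) x v := fun x v => by
    have h1 : ∀ j, ∑ s, M⁻¹ s (e.symm (Sum.inr j)) * M (e.symm v) s =
        if e.symm v = e.symm (Sum.inr j) then 1 else 0 := fun j => by
      rw [← Matrix.one_apply, ← Matrix.mul_nonsing_inv M (isUnit_iff_ne_zero.2 hdet),
        Matrix.mul_apply]
      exact Finset.sum_congr rfl fun s _ => mul_comm _ _
    have h2 : F.eval x (p v) = ∑ j, x j * ∑ s, M⁻¹ s (e.symm (Sum.inr j)) * M (e.symm v) s := by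
      rw [hF]
      simp only [Finset.mul_sum]
      rw [Finset.sum_comm]
      refine Finset.sum_congr rfl fun s _ => ?_
      simp only [ℓ, sum_apply, smul_apply,
        ContinuousLinearMap.proj_apply, smul_eq_mul, Finset.sum_mul, hM, Matrix.of_apply,
        Equiv.apply_symm_apply]
      exact Finset.sum_congr rfl fun j _ => by ring
    rw [h2]
    simp only [h1, e.symm.injective.eq_iff]
    rcases v with i | j <;> simp
  exact ⟨F, ⟨fun x i => hval x (Sum.inl i), fun x j => hval x (Sum.inr j)⟩⟩

/-! ### A second realization of a generic bipartite framework -/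

/-- A nonnegative quadratic form on `ℝ^d`, written as a perturbation of the squared norm, is the
squared norm of a linear map. -/
lemma exists_norm_sq_eq {d : ℕ}
    (b : EuclideanSpace ℝ (Fin d) →L[ℝ] EuclideanSpace ℝ (Fin d) →L[ℝ] ℝ)
    (h : ∀ z, 0 ≤ ‖z‖ ^ 2 + b z z) :
    ∃ T : EuclideanSpace ℝ (Fin d) →ₗ[ℝ] EuclideanSpace ℝ (Fin d), 
      ∀ z, ‖T z‖ ^ 2 = ‖z‖ ^ 2 + b z z := by
  classical
  open scoped Matrix MatrixOrder in
  let e : Fin d → EuclideanSpace ℝ (Fin d) := fun i => EuclideanSpace.single i 1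
  let N : Matrix (Fin d) (Fin d) ℝ := fun i j => (b (e i) (e j) + b (e j) (e i)) / 2
  have hN : ∀ z : EuclideanSpace ℝ (Fin d), z.ofLp ⬝ᵥ N *ᵥ z.ofLp = b z z := fun z => by
    have hz : z = ∑ i, z i • e i := by
      have := (EuclideanSpace.basisFun (Fin d) ℝ).sum_repr z
      simpa [e] using this.symm
    have h1 : b z z = ∑ i, ∑ j, z i * (z j * b (e i) (e j)) := by
      conv_lhs => rw [hz]
      simp only [map_sum, map_smul, sum_apply, smul_apply, smul_eq_mul, Finset.mul_sum]
      rw [Finset.sum_comm]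
      exact Finset.sum_congr rfl fun i _ => Finset.sum_congr rfl fun j _ => by ring
    have h2 : b z z = ∑ i, ∑ j, z i * (z j * b (e j) (e i)) := by
      rw [h1, Finset.sum_comm]
      exact Finset.sum_congr rfl fun i _ => Finset.sum_congr rfl fun j _ => by ring
    have h3 : z.ofLp ⬝ᵥ N *ᵥ z.ofLp = (b z z + b z z) / 2 := by
      nth_rewrite 1 [h1]
      rw [h2]
      simp only [dotProduct, Matrix.mulVec, N, Finset.mul_sum]
      rw [← Finset.sum_add_distrib, Finset.sum_div]
      refine Finset.sum_congr rfl fun i _ => ?_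
      rw [← Finset.sum_add_distrib, Finset.sum_div]
      exact Finset.sum_congr rfl fun j _ => by ring
    rw [h3]; ring
  let M := 1 + N
  have hM : ∀ z : EuclideanSpace ℝ (Fin d), z.ofLp ⬝ᵥ M *ᵥ z.ofLp = ‖z‖ ^ 2 + b z z := fun z => by
    rw [Matrix.add_mulVec, Matrix.one_mulVec, dotProduct_add, hN, EuclideanSpace.real_norm_sq_eq]
    simp [dotProduct, sq]
  have hpsd : M.PosSemidef := by
    refine Matrix.PosSemidef.of_dotProduct_mulVec_nonneg ?_ fun x => ?_
    · refine Matrix.isHermitian_one.add ?_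
      ext i j
      rw [Matrix.conjTranspose_apply, star_trivial]
      simp only [N]
      ring
    · have := hM (WithLp.toLp 2 x)
      simp only [star_trivial]
      rw [this]
      exact h _
  obtain ⟨B, hB⟩ := CStarAlgebra.nonneg_iff_eq_star_mul_self.1 hpsd.nonneg
  refine ⟨Matrix.toEuclideanLin B, fun z => ?_⟩
  rw [← hM z, hB, EuclideanSpace.real_norm_sq_eq, Matrix.star_eq_conjTranspose,
    ← Matrix.mulVec_mulVec, Matrix.dotProduct_mulVec, Matrix.conjTranspose_eq_transpose_of_trivial,
    Matrix.vecMul_transpose]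
  simp [dotProduct, sq, Matrix.toEuclideanLin]

namespace QuadFamily

variable {X E : Type*} [NormedAddCommGroup X] [NormedSpace ℝ X]
  [NormedAddCommGroup E] [InnerProductSpace ℝ E] (F : QuadFamily X E)

/-- Where `gap c` attains the minimum `0` it is a pure square. -/
lemma gap_eq_of_isMin {c : E} {x : X} {y₀ : E} (h0 : F.gap c x y₀ = 0)
    (hnn : ∀ y, 0 ≤ F.gap c x y) (y : E) :
    F.gap c x y = ‖y - y₀‖ ^ 2 + F.bil x (y - y₀) (y - y₀) := by
  set z := y - y₀ with hz
  have hexp : ∀ t : ℝ, F.gap c x (y₀ + t • z) =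
      t * (2 * inner ℝ (y₀ - c) z + (F.bil x y₀ z + F.bil x z y₀ + F.lin x z)) +
        t ^ 2 * (‖z‖ ^ 2 + F.bil x z z) := fun t => by
    rw [gap] at h0
    rw [gap, eval_add_smul, add_sub_right_comm, norm_add_sq_real, inner_smul_right, norm_smul,
      mul_pow, Real.norm_eq_abs, sq_abs]
    linear_combination h0
  set L := 2 * inner ℝ (y₀ - c) z + (F.bil x y₀ z + F.bil x z y₀ + F.lin x z)
  have hL : L = 0 := by
    have := discrim_le_zero (a := ‖z‖ ^ 2 + F.bil x z z) (b := L) (c := 0) fun t => by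
      have := hnn (y₀ + t • z)
      rw [hexp] at this
      linarith
    rw [discrim] at this
    nlinarith [sq_nonneg L]
  have := hexp 1
  rw [hL, one_smul, hz, add_sub_cancel] at this
  rw [this]
  ring

end QuadFamily

/-- A quadratic form that vanishes on the differences of spanning points vanishes. -/
lemma AffinelySpanning.bil_self_eq_zero {ι E : Type*} [NormedAddCommGroup E] [NormedSpace ℝ E]
    {p : ι → E} (hp : AffinelySpanning p) [Nonempty ι] (b : E →L[ℝ] E →L[ℝ] ℝ)
    (h : ∀ i k, b (p i - p k) (p i - p k) = 0) (z : E) : b z z = 0 := by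
  obtain ⟨o⟩ := (inferInstance : Nonempty ι)
  have hpolar : ∀ i k, b (p i - p o) (p k - p o) + b (p k - p o) (p i - p o) = 0 := fun i k => by
    have h1 := h i k
    have h2 := h i o
    have h3 := h k o
    rw [← sub_sub_sub_cancel_right _ _ (p o)] at h1
    simp only [map_sub, sub_apply] at h1 h2 h3 ⊢
    linarith
  have hleft : ∀ k, b.flip (p k - p o) + b (p k - p o) = 0 := fun k => by
    refine hp _ ((b.flip (p k - p o) + b (p k - p o)) (p o)) fun i => ?_
    have := hpolar i k
    simp only [map_sub, sub_apply, add_apply, ContinuousLinearMap.flip_apply] at this ⊢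
    linarith
  have hright : b z + b.flip z = 0 := by
    refine hp _ ((b z + b.flip z) (p o)) fun k => ?_
    have := congrArg (fun ℓ => ℓ z) (hleft k)
    simp only [map_sub, sub_apply, add_apply, ContinuousLinearMap.flip_apply,
      zero_apply] at this ⊢
    linarith
  have := congrArg (fun ℓ => ℓ z) hright
  simp only [add_apply, ContinuousLinearMap.flip_apply, zero_apply] at this
  linarith

lemma halfSqLength_mk {V : Type*} {d : ℕ} (G : SimpleGraph V) (p : V → EuclideanSpace ℝ (Fin d))
    {u v : V} (h : s(u, v) ∈ G.edgeSet) : halfSqLength G p ⟨s(u, v), h⟩ = ‖p u - p v‖ ^ 2 / 2 :=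
  rfl

lemma IsGeneric.comp {V W : Type*} {d : ℕ} {p : V → EuclideanSpace ℝ (Fin d)} (hp : IsGeneric p)
    {f : W → V} (hf : Function.Injective f) : IsGeneric (p ∘ f) :=
  AlgebraicIndependent.comp hp (fun x : W × Fin d => (f x.1, x.2)) fun _ _ hab =>
    Prod.ext (hf (congrArg (fun z : V × Fin d => z.1) hab))
      (congrArg (fun z : V × Fin d => z.2) hab)

/-- A bipartite graph with `(d + 2).choose 2` vertices and at least `d + 2` vertices in each class
has no globally rigid generic realization. -/
theorem IsGeneric.not_isGloballyRigid {V : Type*} [Fintype V] {d : ℕ} (G : SimpleGraph V)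
    (P : V → Prop) [DecidablePred P] (hG : ∀ u v, G.Adj u v → (P u ↔ ¬ P v))
    (hcard : Fintype.card V = (d + 2).choose 2) (hI : d + 2 ≤ Fintype.card {v // P v})
    (hJ : d + 2 ≤ Fintype.card {v // ¬ P v}) {p : V → EuclideanSpace ℝ (Fin d)}
    (hp : IsGeneric p) : ¬ IsGloballyRigid G p := by
  let e : {v // P v} ⊕ {v // ¬ P v} ≃ V := Equiv.sumCompl P
  obtain ⟨F, hF⟩ := (hp.comp e.injective).exists_interpolates
    ((Fintype.card_congr e).trans hcard)
  have hpI : AffinelySpanning ((p ∘ e) ∘ Sum.inl) :=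
    (hp.comp (e.injective.comp Sum.inl_injective)).affinelySpanning (by omega)
  have hpJ : AffinelySpanning ((p ∘ e) ∘ Sum.inr) :=
    (hp.comp (e.injective.comp Sum.inr_injective)).affinelySpanning (by omega)
  have : Nonempty {v // P v} := Fintype.card_pos_iff.1 (by omega)
  have : Nontrivial {v // ¬ P v} := Fintype.one_lt_card_iff_nontrivial.1 (by omega)
  obtain ⟨x, hx0, hnn, htight⟩ := hF.exists_tight hpI hpJ
  choose y hy using htight
  obtain ⟨T, hT⟩ := exists_norm_sq_eq (F.bil x) fun z =>
    (QuadFamily.coeff_of_bounded_below fun t => by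
      rw [← F.gap_add_smul]
      exact hnn (Classical.arbitrary _) _).1
  -- `T (y j)` is the new position of the `j`-th vertex of the second class.
  let q : V → EuclideanSpace ℝ (Fin d) := fun v => if h : P v then T (p v) else T (y ⟨v, h⟩)
  have hcross : ∀ u v, P u → ¬ P v → ‖p u - p v‖ ^ 2 = ‖q u - q v‖ ^ 2 := fun u v hu hv => by
    have h1 := F.gap_eq_of_isMin (hy ⟨v, hv⟩) (hnn ⟨v, hv⟩) (p u)
    have h2 : F.eval x (p u) = 0 := hF.eval_left x ⟨u, hu⟩
    rw [QuadFamily.gap, h2, add_zero, ← hT, map_sub] at h1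
    simp only [q, dif_pos hu, dif_neg hv]
    exact h1
  intro hrigid
  have hall := hrigid q <| by
    funext ⟨s, hs⟩
    induction s using Sym2.ind with
    | _ u v =>
      rw [halfSqLength_mk, halfSqLength_mk]
      have hside := hG u v hs
      by_cases hv : P v
      · have hu : ¬ P u := fun hu => hside.1 hu hv
        rw [norm_sub_rev (p u), norm_sub_rev (q u), hcross v u hv hu]
      · rw [hcross u v (hside.2 hv) hv]
  refine hx0 (hF.eq_zero hpI fun z => hpI.bil_self_eq_zero _ (fun i k => ?_) z)
  change F.bil x (p i.1 - p k.1) (p i.1 - p k.1) = 0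
  by_cases hik : i.1 = k.1
  · simp [hik]
  · have h1 := congrFun hall ⟨s(i.1, k.1), (SimpleGraph.mem_edgeSet _).2 hik⟩
    rw [halfSqLength_mk, halfSqLength_mk] at h1
    simp only [q, dif_pos i.2, dif_pos k.2] at h1
    have h2 := hT (p i.1 - p k.1)
    rw [map_sub] at h2
    linarith

/-! ### Chains -/

lemma chain_adj {k : ℕ} {a : Fin k → ℕ} {u v : Σ i : Fin k, Fin (a i)} :
    (chain a).Adj u v ↔ (u.1 : ℕ) + 1 = v.1 ∨ (v.1 : ℕ) + 1 = u.1 := Iff.rfl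

/-- Removing an interior class of a chain separates the classes before it from those after it. -/
lemma VertexConnected.le_of_interior {k n : ℕ} {a : Fin k → ℕ} (ha : ∀ i, 0 < a i)
    (h : VertexConnected (chain a) n) (i : Fin k) (hi0 : 0 < (i : ℕ)) (hik : (i : ℕ) + 1 < k) :
    n ≤ a i := by
  classical
  by_contra! hlt
  let S : Finset (Σ i : Fin k, Fin (a i)) := Finset.univ.map (Function.Embedding.sigmaMk i)
  have hS : ∀ v, v ∈ S ↔ v.1 = i := fun v => by
    simp only [S, Finset.mem_map, Finset.mem_univ, true_and, Function.Embedding.sigmaMk_apply]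
    constructor
    · rintro ⟨w, rfl⟩; rfl
    · obtain ⟨j, w⟩ := v
      rintro rfl
      exact ⟨w, rfl⟩
  have hconn := h.2 S (by simpa [S] using hlt)
  have hwalk : ∀ u v : ((S : Set (Σ i : Fin k, Fin (a i)))ᶜ : Set _),
      ((chain a).induce _).Reachable u v → (u.1.1 : ℕ) < i → (v.1.1 : ℕ) < i := by
    rintro u v ⟨w⟩ hu
    induction w with
    | nil => exact hu
    | @cons u v' _ hadj _ ih =>
      refine ih ?_
      have hne : (v'.1.1 : ℕ) ≠ i := fun heq =>
        v'.2 (Finset.mem_coe.2 ((hS _).2 (Fin.ext heq)))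
      rcases chain_adj.1 (SimpleGraph.induce_adj.1 hadj) with h | h <;> omega
  let first : Σ i : Fin k, Fin (a i) := ⟨⟨0, by omega⟩, ⟨0, ha _⟩⟩
  let last : Σ i : Fin k, Fin (a i) := ⟨⟨k - 1, by omega⟩, ⟨0, ha _⟩⟩
  have hfirst : first ∉ S := fun hmem => hi0.ne (congrArg Fin.val ((hS _).1 hmem))
  have hlast : last ∉ S := fun hmem => by
    have := congrArg Fin.val ((hS _).1 hmem)
    simp only [last] at this
    omega
  have := hwalk ⟨first, hfirst⟩ ⟨last, hlast⟩ (hconn.preconnected _ _) hi0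
  simp only [last] at this
  omega

/-- The vertices of two classes of a chain that satisfy `P` are at least as many as the elements
of the two classes. -/
lemma add_le_card_subtype {k : ℕ} {a : Fin k → ℕ} (P : (Σ i : Fin k, Fin (a i)) → Prop)
    [DecidablePred P] {i j : Fin k} (hij : i ≠ j) (hi : ∀ w, P ⟨i, w⟩) (hj : ∀ w, P ⟨j, w⟩) :
    a i + a j ≤ Fintype.card {v // P v} := by
  rw [← Fintype.card_fin (a i), ← Fintype.card_fin (a j), ← Fintype.card_sum]
  refine Fintype.card_le_of_injective
    (Sum.elim (fun w => ⟨⟨i, w⟩, hi w⟩) fun w => ⟨⟨j, w⟩, hj w⟩) ?_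
  rintro (v | v) (w | w) h
  · simpa using h
  · exact absurd (congrArg (fun x => x.1.1) h) hij
  · exact absurd (congrArg (fun x => x.1.1) h) hij.symm
  · simpa using h

end Rigidity

theorem proposition2p3 (d k : ℕ) (hk : 4 ≤ k) (a : Fin k → ℕ) (ha : ∀ i, 0 < a i)
    (hcard : Fintype.card (Σ i : Fin k, Fin (a i)) = (d + 2).choose 2)
    (hconn : Rigidity.VertexConnected (Rigidity.chain a) (d + 1)) :
    ¬ Rigidity.GenericallyGloballyRigid d (Rigidity.chain a) ∧
    ∃ m n : ℕ, d + 2 ≤ m ∧ d + 2 ≤ n ∧ m + n = (d + 2).choose 2 ∧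
      (Rigidity.chain a).IsContained (completeBipartiteGraph (Fin m) (Fin n)) := by
  let P : (Σ i : Fin k, Fin (a i)) → Prop := fun v => Even (v.1 : ℕ)
  have hG : ∀ u v, (Rigidity.chain a).Adj u v → (P u ↔ ¬ P v) := by
    intro u v huv
    simp only [P]
    rcases Rigidity.chain_adj.1 huv with h | h
    · rw [← h, Nat.even_add_one, not_not]
    · rw [← h, Nat.even_add_one]
  -- Each side contains an interior class and one further class.
  have hI : d + 2 ≤ Fintype.card {v // P v} := by
    have h1 := Rigidity.add_le_card_subtype P (i := ⟨0, by omega⟩) (j := ⟨2, by omega⟩) (by simp)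
      (fun _ => Even.zero) (fun _ => even_two)
    have h2 := hconn.le_of_interior ha ⟨2, by omega⟩ (by simp) (by simp only; omega)
    have h3 := ha ⟨0, by omega⟩
    omega
  have hJ : d + 2 ≤ Fintype.card {v // ¬ P v} := by
    have h1 := Rigidity.add_le_card_subtype (fun v => ¬ P v) (i := ⟨1, by omega⟩)
      (j := ⟨3, by omega⟩) (by simp) (fun _ => by simp [P]) (fun _ => by simp [P]; decide)
    have h2 := hconn.le_of_interior ha ⟨1, by omega⟩ (by simp) (by simp only; omega)
    have h3 := ha ⟨3, by omega⟩
    omega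
  refine ⟨fun ⟨p, hp, hrigid⟩ => hp.not_isGloballyRigid _ P hG hcard hI hJ hrigid,
    Fintype.card {v // P v}, Fintype.card {v // ¬ P v}, hI, hJ, ?_, ?_⟩
  · rw [← hcard, ← Fintype.card_sum]
    exact Fintype.card_congr (Equiv.sumCompl P)
  · let e := (Equiv.sumCompl P).symm.trans
      (Equiv.sumCongr (Fintype.equivFin {v // P v}) (Fintype.equivFin {v // ¬ P v}))
    refine ⟨⟨⟨e, fun {u v} huv => ?_⟩, e.injective⟩⟩
    have h := hG u v huv
    by_cases hv : P v
    · have hu : ¬ P u := fun hu => h.1 hu hv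
      simp [e, hu, hv]
    · have hu := h.2 hv
      simp [e, hu, hv]
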